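/- An instance of STEINER-TREE consists of a finite simple graph $G=(V,E)$, directed or undirected, a length function $\ell:E\to\mathbb{Q}_{\ge 0}$, a root $r\in V$ from which every vertex can be reached, and a set $T\subseteq V\setminus\{r\}$ of $K\ge 2$ terminals. A Steiner tree is a directed tree $S$ in $G$ rooted at $r$ that contains all terminals (if $G$ is undirected, every arc $(u,v)$ of $S$ must come from an edge $[u,v]$ of $G$); its length $\ell(S)$ is the sum of the lengths of its arcs, and STEINER-TREE asks for a Steiner tree of minimum length. An instance of ML-CAP-STEINER-TREE has in addition a positive integer capacity $c(e)$ for every $e\in E$; a feasible solution is a Steiner tree $S$ such that, for every arc $e=(u,v)$ of $S$, the subtree of $S$ rooted at $v$ contains at most $c(e)$ terminals. ML-CAP-STEINER-TREE asks for a feasible solution of minimum length, if one exists; CAP-STEINER-TREE asks whether there is a feasible solution. The number $K$ of terminals is part of the input, and numbers are written in binary. Theorem. Let $\mathcal{C}$ be one of the following three classes of graphs: digraphs, directed acyclic graphs, undirected graphs. (i) On the instances with graph in $\mathcal{C}$ and $c(e)\ge K-1$ for all $e\in E$, CAP-STEINER-TREE is solvable in polynomial time. (ii) Let $\rho\ge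 1$ (a constant or, more generally, a function of the STEINER-TREE instance) be such that STEINER-TREE on graphs in $\mathcal{C}$ has a polynomial-time $\rho$-approximation algorithm, i.e. one that returns, for each instance, a Steiner tree of length at most $\rho$ times the minimum. Then ML-CAP-STEINER-TREE, on the instances with graph in $\mathcal{C}$ and $c(e)\ge K-1$ for all $e\in E$, has a polynomial-time $(1+\rho)$-approximation algorithm: if there is a feasible solution, it returns a feasible solution of length at most $1+\rho$ times the minimum, and otherwise it reports that there is none. (If $\rho$ varies with the instance, its value here is the one at the STEINER-TREE instance obtained by dropping the capacities.) -/

import Mathlib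

/-! ### The machine model

Programs over binary trees whose leaves are natural numbers (written in binary), with a step count.
Every elementary instruction is charged the size of its argument plus the size of its result
(logarithmic cost criterion), so that the running time bounds the size of everything that is
computed. A multi-tape Turing machine simulates these programs, and is simulated by them, with
polynomial overhead; hence "polynomial time" below is the usual notion. -/

/-- The data handled by programs: natural numbers and pairs. -/
inductive Value : Type
  | nat (n : ℕ) : Value
  | pair (a b : Value) : Value
  deriving DecidableEq

namespace Value

/-- Size of a datum: numbers count with their binary length `Nat.size`. -/
def size : Value → ℕ
  | nat n => Nat.size n + 1
  | pair a b => a.size + b.size + 1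

/-- Lists as nested pairs, ended by the number `0`. -/
def ofList : List Value → Value
  | [] => nat 0
  | v :: l => pair v (ofList l)

end Value

/-- The elementary instructions. -/
inductive Instr : Type
  | id
  | const (n : ℕ)
  | fst
  | snd
  | add
  | sub
  | mul
  | div
  | lt
  | eq

/-- The effect of an elementary instruction. Arithmetic works on a pair of numbers, equality on an
arbitrary pair; a truth value is `1` or `0`; an ill-typed application yields `0`. -/
def Instr.apply : Instr → Value → Value
  | .id, v => v
  | .const n, _ => .nat n
  | .fst, .pair a _ => a
  | .snd, .pair _ b => b
  | .add, .pair (.nat a) (.nat b) => .nat (a + b)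
  | .sub, .pair (.nat a) (.nat b) => .nat (a - b)
  | .mul, .pair (.nat a) (.nat b) => .nat (a * b)
  | .div, .pair (.nat a) (.nat b) => .nat (a / b)
  | .lt, .pair (.nat a) (.nat b) => .nat (if a < b then 1 else 0)
  | .eq, .pair a b => .nat (if a = b then 1 else 0)
  | _, _ => .nat 0

/-- Programs: elementary instructions, sequencing, pairing, conditional, while-loop. -/
inductive Prog : Type
  | instr (o : Instr)
  | seq (f g : Prog)
  | pair (f g : Prog)
  | cond (p f g : Prog)
  | loop (p f : Prog)

/-- `Prog.Eval P v w t`: the program `P`, started on the datum `v`, halts after `t` steps with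
result `w`. In tests, `0` means false and everything else means true; `loop p f` replaces the
current datum by the result of `f` as long as the test `p` is true. -/
inductive Prog.Eval : Prog → Value → Value → ℕ → Prop
  | instr (o : Instr) (v : Value) :
      Eval (.instr o) v (o.apply v) (1 + v.size + (o.apply v).size)
  | seq {f g : Prog} {u v w : Value} {s t : ℕ} :
      Eval f u v s → Eval g v w t → Eval (.seq f g) u w (1 + s + t)
  | pair {f g : Prog} {u v w : Value} {s t : ℕ} :
      Eval f u v s → Eval g u w t → Eval (.pair f g) u (.pair v w) (1 + u.size + s + t)
  | cond_true {p f g : Prog} {u b w : Value} {s t : ℕ} :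
      Eval p u b s → b ≠ .nat 0 → Eval f u w t → Eval (.cond p f g) u w (1 + u.size + s + t)
  | cond_false {p f g : Prog} {u w : Value} {s t : ℕ} :
      Eval p u (.nat 0) s → Eval g u w t → Eval (.cond p f g) u w (1 + u.size + s + t)
  | loop_stop {p f : Prog} {u : Value} {s : ℕ} :
      Eval p u (.nat 0) s → Eval (.loop p f) u u (1 + u.size + s)
  | loop_step {p f : Prog} {u b v w : Value} {s t t' : ℕ} :
      Eval p u b s → b ≠ .nat 0 → Eval f u v t → Eval (.loop p f) v w t' →
        Eval (.loop p f) u w (1 + u.size + s + t + t')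

/-- The problem with instances `x : ι`, written `input x`, and with correct answers `R x` is solved
by a program whose running time is at most a polynomial in the size of the written instance. -/
def PolyTimeSolvable {ι : Type} (input : ι → Value) (R : ι → Value → Prop) : Prop :=
  ∃ (P : Prog) (p : Polynomial ℕ), ∀ x : ι, ∃ (y : Value) (t : ℕ),
    P.Eval (input x) y t ∧ t ≤ p.eval (input x).size ∧ R x y

/-! ### Rooted trees -/

/-- There is a directed path from `u` to `v` using arcs of `F` only. -/
def Reaches {V : Type} (F : Finset (V × V)) (u v : V) : Prop :=
  Relation.ReflTransGen (fun x y => (x, y) ∈ F) u v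

/-- `F` is the arc set of a directed tree rooted at `r`: no arc enters `r`, at most one arc enters
any vertex, and every arc can be reached from `r` inside `F`. (The vertices of the tree are `r` and
the ends of its arcs.) -/
structure IsTreeRootedAt {V : Type} (r : V) (F : Finset (V × V)) : Prop where
  root_no_entering : ∀ a ∈ F, a.2 ≠ r
  entering_unique : ∀ a ∈ F, ∀ b ∈ F, a.2 = b.2 → a = b
  reachable : ∀ a ∈ F, Reaches F r a.1

/-! ### The problems -/

/-- An instance of STEINER-TREE: a simple graph on the vertices `0, …, n - 1` given by its arcs (an
undirected edge is a pair of opposite arcs), nonnegative rational lengths, a root from which every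
vertex can be reached, and at least two terminals different from the root. Only the lengths of the
arcs of the graph matter. -/
structure SteinerInstance where
  n : ℕ
  arcs : Finset (Fin n × Fin n)
  length : Fin n × Fin n → ℚ≥0
  root : Fin n
  terminals : Finset (Fin n)
  loopless : ∀ a ∈ arcs, a.1 ≠ a.2
  root_reaches : ∀ v, Reaches arcs root v
  root_notMem : root ∉ terminals
  two_le_card : 2 ≤ terminals.card

/-- An instance of ML-CAP-STEINER-TREE: moreover, every arc has a positive integer capacity. -/
structure CapSteinerInstance extends SteinerInstance where
  cap : Fin n × Fin n → ℕ
  cap_pos : ∀ a ∈ arcs, 0 < cap a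

/-- The three types of graphs. -/
inductive GraphClass : Type
  | digraph
  | dag
  | undirected

namespace SteinerInstance

/-- The graph of the instance has the given type. An undirected graph is a symmetric one, the two
arcs of an edge having the same length. -/
def InClass (I : SteinerInstance) : GraphClass → Prop
  | .digraph => True
  | .dag => ∀ v, ¬ Relation.TransGen (fun x y => (x, y) ∈ I.arcs) v v
  | .undirected => ∀ a ∈ I.arcs, a.swap ∈ I.arcs ∧ I.length a.swap = I.length a

/-- The arcs of the graph, in lexicographic order. -/
def arcList (I : SteinerInstance) : List (Fin I.n × Fin I.n) :=
  (List.finRange I.n ×ˢ List.finRange I.n).filter (fun a => a ∈ I.arcs)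

/-- The terminals, in increasing order. -/
def terminalList (I : SteinerInstance) : List (Fin I.n) :=
  (List.finRange I.n).filter (fun v => v ∈ I.terminals)

/-- The instance as input of a program: `n`, the root, the list of terminals, and the list of arcs
`(u, v)` with numerator and denominator of their lengths. -/
def input (I : SteinerInstance) : Value :=
  .pair (.nat I.n) <| .pair (.nat I.root) <|
    .pair (.ofList (I.terminalList.map fun t => .nat t)) <|
      .ofList (I.arcList.map fun a =>
        .pair (.pair (.nat a.1) (.nat a.2)) (.pair (.nat (I.length a).num) (.nat (I.length a).den)))

/-- Total length of a set of arcs. -/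
def totalLength (I : SteinerInstance) (F : Finset (Fin I.n × Fin I.n)) : ℚ≥0 :=
  ∑ a ∈ F, I.length a

/-- `F` is a directed tree of the graph that is rooted at the root and spans all terminals. -/
structure IsSteinerTree (I : SteinerInstance) (F : Finset (Fin I.n × Fin I.n)) : Prop where
  subset : F ⊆ I.arcs
  tree : IsTreeRootedAt I.root F
  spans : ∀ t ∈ I.terminals, Reaches F I.root t

end SteinerInstance

/-- A list of arcs as output of a program. -/
def arcsOutput {n : ℕ} (L : List (Fin n × Fin n)) : Value :=
  .ofList (L.map fun a => .pair (.nat a.1) (.nat a.2))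

namespace CapSteinerInstance

/-- As for `SteinerInstance`; in an undirected graph the two arcs of an edge also have the same
capacity. -/
def InClass (I : CapSteinerInstance) (C : GraphClass) : Prop :=
  I.toSteinerInstance.InClass C ∧ (C = .undirected → ∀ a ∈ I.arcs, I.cap a.swap = I.cap a)

/-- The instance as input of a program: as for `SteinerInstance`, with capacities. -/
def input (I : CapSteinerInstance) : Value :=
  .pair (.nat I.n) <| .pair (.nat I.root) <|
    .pair (.ofList (I.terminalList.map fun t => .nat t)) <|
      .ofList (I.arcList.map fun a =>
        .pair (.pair (.nat a.1) (.nat a.2))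
          (.pair (.pair (.nat (I.length a).num) (.nat (I.length a).den)) (.nat (I.cap a))))

/-- `F` is a feasible solution: a Steiner tree such that, for each of its arcs `(u, v)`, the subtree
rooted at `v` contains at most `c (u, v)` terminals. -/
structure IsFeasible (I : CapSteinerInstance) (F : Finset (Fin I.n × Fin I.n)) : Prop where
  steiner : I.IsSteinerTree F
  capacity : ∀ a ∈ F, {t | t ∈ I.terminals ∧ Reaches F a.2 t}.ncard ≤ I.cap a

/-- All capacities are at least `K - 1`, where `K` is the number of terminals. -/
def LargeCapacities (I : CapSteinerInstance) : Prop :=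
  ∀ a ∈ I.arcs, I.terminals.card - 1 ≤ I.cap a

end CapSteinerInstance

/-- In graphs of type `C`, STEINER-TREE is approximable in polynomial time within the ratio `ρ`
(which may vary with the instance): the program outputs the arcs of a Steiner tree that is at most
`ρ` times as long as any Steiner tree. -/
def SteinerApproximable (C : GraphClass) (ρ : SteinerInstance → ℝ) : Prop :=
  PolyTimeSolvable (ι := {I : SteinerInstance // I.InClass C}) (fun I => I.1.input) fun I y =>
    ∃ L : List (Fin I.1.n × Fin I.1.n), y = arcsOutput L ∧ I.1.IsSteinerTree L.toFinset ∧
      ∀ F, I.1.IsSteinerTree F →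
        (I.1.totalLength L.toFinset : ℝ) ≤ ρ I.1 * (I.1.totalLength F : ℝ)

/-- In graphs of type `C` with all capacities at least `K - 1`, CAP-STEINER-TREE is decided in
polynomial time: the program outputs `1` if there is a feasible solution and `0` otherwise.
(Feasibility does not depend on the lengths, which may be all `0`.) -/
def CapSteinerPolyTime (C : GraphClass) : Prop :=
  PolyTimeSolvable (ι := {I : CapSteinerInstance // I.InClass C ∧ I.LargeCapacities})
    (fun I => I.1.input) fun I y =>
      ((∃ F, I.1.IsFeasible F) → y = .nat 1) ∧ ((¬ ∃ F, I.1.IsFeasible F) → y = .nat 0)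

/-- In graphs of type `C` with all capacities at least `K - 1`, ML-CAP-STEINER-TREE is approximable
in polynomial time within the ratio `α` (which may vary with the instance): the program outputs the
arcs of a feasible solution (marked by a leading `1`) that is at most `α` times as long as any
feasible solution, or it outputs `0` and there is no feasible solution. -/
def CapSteinerApproximable (C : GraphClass) (α : CapSteinerInstance → ℝ) : Prop :=
  PolyTimeSolvable (ι := {I : CapSteinerInstance // I.InClass C ∧ I.LargeCapacities})
    (fun I => I.1.input) fun I y =>
      (∃ L : List (Fin I.1.n × Fin I.1.n), y = .pair (.nat 1) (arcsOutput L) ∧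
        I.1.IsFeasible L.toFinset ∧
        ∀ F, I.1.IsFeasible F →
          (I.1.totalLength L.toFinset : ℝ) ≤ α I.1 * (I.1.totalLength F : ℝ)) ∨
      (y = .nat 0 ∧ ¬ ∃ F, I.1.IsFeasible F)

/-!
Call an arc *good* if its capacity is at least the number `K` of terminals. The other arcs have
capacity `K - 1`, hence a Steiner tree is feasible if and only if none of its arcs that are not good
carries all terminals (`IsFeasibleTree`).

*Feasibility.* An arc set contains a feasible tree if and only if the root reaches all terminals and
no vertex that cannot be reached by good arcs separates the root from all terminals
(`NoBottleneck`). Necessity: if a vertex separates, then the arc of the tree that enters it and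
all arcs above carry all terminals, so they are good (`IsFeasibleTree.noBottleneck`). Sufficiency:
let `W` be the set of the vertices reached by good arcs. If `W` contains no terminal, Menger's
theorem (`exists_disjoint_joins`) gives two disjoint paths from `W` to terminals. There is a
tree that enters `W` by good arcs only and contains both paths, and no subtree at a vertex
outside `W` contains both ends (`NoBottleneck.exists_isFeasibleTree`). This criterion amounts to
reachability questions, which settles the decision problem. Moreover, deleting arcs as long as the
criterion holds leaves a minimal arc set containing a feasible tree, that is, a feasible tree
(`prune_spec`).

*Approximation.* Let `S` be a Steiner tree of length at most `ρ` times the minimum. It suffices to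
find an arc set `X`, at most as long as any feasible tree `F`, such that `S ∪ X` contains
a feasible tree: pruning `S ∪ X` then gives a tree of length at most `1 + ρ` times the minimum.
Such a set `X` consists of the arcs of a cheapest walk in an auxiliary digraph (`AuxStep`) on two
copies of the vertices. It is similar to the residual graph of a unit flow along the path of `S` to
one terminal, except that going back on this path is free rather than of negative cost, so that all
costs are nonnegative. In the first copy only good arcs are used. A walk to the second copy of a
terminal excludes bottlenecks (`noBottleneck_of_auxReaches`), and every feasible tree `F` yields
such a walk that uses each arc of `F` at most once (`IsFeasibleTree.exists_auxReaches`,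
`exists_cheap_isWalk`).

*Running times.* The programs are not written down. Polynomial-time functions between types of
data (`PolyTime`) are closed under the usual constructions, among them loops over lists whose
accumulator stays polynomially bounded (`PolyTime.foldl`). The algorithms are functions on lists of
natural numbers built from these constructions. Cheapest walks are computed by the Bellman-Ford
algorithm with labels that carry the arcs used (`labels`); the lengths are made integral by
multiplication with the product of all denominators.
-/

/-! ### Polynomial-time computable functions -/

theorem Polynomial.eval_mono_nat (p : Polynomial ℕ) {a b : ℕ} (h : a ≤ b) :
    p.eval a ≤ p.eval b := by
  rw [Polynomial.eval_eq_sum_range, Polynomial.eval_eq_sum_range]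
  gcongr

theorem Nat.size_mul_le (a b : ℕ) : Nat.size (a * b) ≤ Nat.size a + Nat.size b := by
  rw [Nat.size_le, pow_add]
  have ha := Nat.lt_size_self a
  have hb := Nat.lt_size_self b
  exact Nat.mul_lt_mul'' ha hb

theorem Nat.size_add_le (a b : ℕ) : Nat.size (a + b) ≤ Nat.size a + Nat.size b := by
  rw [Nat.size_le, pow_add]
  have ha : a + 1 ≤ 2 ^ Nat.size a := Nat.lt_size_self a
  have hb : b + 1 ≤ 2 ^ Nat.size b := Nat.lt_size_self b
  nlinarith [Nat.mul_le_mul ha hb]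

theorem Instr.exists_size_apply_le (o : Instr) : ∃ c, ∀ v, (o.apply v).size ≤ v.size + c := by
  cases o with
  | const n => exact ⟨Nat.size n + 1, fun v => by simp [Instr.apply, Value.size]⟩
  | id => exact ⟨0, fun v => by simp [Instr.apply]⟩
  | _ =>
    refine ⟨2, fun v => ?_⟩
    rcases v with n | ⟨_ | _, _ | _⟩ <;> simp only [Instr.apply, Value.size] <;>
    first
    | (simp; done)
    | (simp; omega)
    | (rename_i a b
       first
       | (have := Nat.size_add_le a b; omega)
       | (have := Nat.size_mul_le a b; omega)
       | (have := Nat.size_le_size (Nat.sub_le a b); omega)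
       | (have := Nat.size_le_size (Nat.div_le_self a b); omega))
    | (split_ifs <;> simp)

/-- The running time bounds the size of the result. -/
theorem Prog.Eval.size_le {P : Prog} {v w : Value} {t : ℕ} (h : P.Eval v w t) : w.size ≤ t := by
  induction h with
  | pair _ _ _ _ => simp only [Value.size]; omega
  | loop_stop h _ => omega
  | _ => omega

/-- One program turns `f i` into `g i`, for every index `i`, in time polynomial in the size of
`f i`. -/
def Computes {ι : Type} (f g : ι → Value) : Prop :=
  ∃ (P : Prog) (p : Polynomial ℕ), ∀ i, ∃ t, P.Eval (f i) (g i) t ∧ t ≤ p.eval (f i).size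

namespace Computes

variable {ι κ : Type} {f g h : ι → Value}

theorem instr (o : Instr) : Computes f (fun i => o.apply (f i)) := by
  obtain ⟨c, hc⟩ := o.exists_size_apply_le
  refine ⟨.instr o, 1 + 2 * Polynomial.X + Polynomial.C c, fun i => ⟨_, .instr o _, ?_⟩⟩
  simp only [Polynomial.eval_add, Polynomial.eval_mul, Polynomial.eval_X, Polynomial.eval_C,
    Polynomial.eval_one, Polynomial.eval_ofNat]
  have := hc (f i)
  omega

theorem comp (hg : Computes f g) (hh : Computes g h) : Computes f h := by
  obtain ⟨P, p, hP⟩ := hg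
  obtain ⟨Q, q, hQ⟩ := hh
  refine ⟨.seq P Q, 1 + p + q.comp p, fun i => ?_⟩
  obtain ⟨s, hs, hsp⟩ := hP i
  obtain ⟨t, ht, htq⟩ := hQ i
  refine ⟨_, .seq hs ht, ?_⟩
  have := q.eval_mono_nat (hs.size_le.trans hsp)
  simp only [Polynomial.eval_add, Polynomial.eval_comp, Polynomial.eval_one]
  omega

theorem pair (hg : Computes f g) (hh : Computes f h) :
    Computes f (fun i => .pair (g i) (h i)) := by
  obtain ⟨P, p, hP⟩ := hg
  obtain ⟨Q, q, hQ⟩ := hh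
  refine ⟨.pair P Q, 1 + Polynomial.X + p + q, fun i => ?_⟩
  obtain ⟨s, hs, hsp⟩ := hP i
  obtain ⟨t, ht, htq⟩ := hQ i
  refine ⟨_, .pair hs ht, ?_⟩
  simp only [Polynomial.eval_add, Polynomial.eval_X, Polynomial.eval_one]
  omega

theorem cond {b : ι → Value} (hb : Computes f b) (hg : Computes f g) (hh : Computes f h) :
    Computes f (fun i => if b i = .nat 0 then h i else g i) := by
  obtain ⟨B, p, hB⟩ := hb
  obtain ⟨P, q, hP⟩ := hg
  obtain ⟨Q, r, hQ⟩ := hh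
  refine ⟨.cond B P Q, 1 + Polynomial.X + p + q + r, fun i => ?_⟩
  obtain ⟨s, hs, hsp⟩ := hB i
  simp only [Polynomial.eval_add, Polynomial.eval_X, Polynomial.eval_one]
  split_ifs with h0
  · obtain ⟨t, ht, htq⟩ := hQ i
    rw [h0] at hs
    exact ⟨_, .cond_false hs ht, by omega⟩
  · obtain ⟨t, ht, htq⟩ := hP i
    exact ⟨_, .cond_true hs h0 ht, by omega⟩

theorem reindex (hg : Computes f g) (e : κ → ι) :
    Computes (fun k => f (e k)) (fun k => g (e k)) := by
  obtain ⟨P, p, hP⟩ := hg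
  exact ⟨P, p, fun k => hP (e k)⟩

theorem const (v : Value) : Computes f (fun _ => v) := by
  induction v with
  | nat n => exact instr (.const n)
  | pair a b ha hb => exact ha.pair hb

theorem id : Computes f f := instr .id

end Computes

/-- A type whose elements are written as data for programs. -/
class Enc (α : Type) where
  enc : α → Value

open Enc (enc)

/-- Different elements are written differently. -/
class InjectiveEnc (α : Type) [Enc α] : Prop where
  inj : Function.Injective (enc : α → Value)

section Encodings

variable {α β : Type} [Enc α] [Enc β]

instance : Enc Value := ⟨fun v => v⟩
instance : Enc ℕ := ⟨Value.nat⟩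
instance : Enc Bool := ⟨fun b => .nat b.toNat⟩
instance : Enc (α × β) := ⟨fun p => .pair (enc p.1) (enc p.2)⟩
instance : Enc (List α) := ⟨fun l => .ofList (l.map enc)⟩

theorem enc_nat (n : ℕ) : enc n = .nat n := rfl
theorem enc_prod (p : α × β) : enc p = .pair (enc p.1) (enc p.2) := rfl
theorem enc_cons (a : α) (l : List α) : enc (a :: l) = .pair (enc a) (enc l) := rfl

instance : InjectiveEnc ℕ := ⟨fun _ _ h => by simpa [enc_nat] using h⟩
instance [InjectiveEnc α] [InjectiveEnc β] : InjectiveEnc (α × β) :=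
  ⟨fun p q h => by
    simp only [enc_prod, Value.pair.injEq] at h
    exact Prod.ext (InjectiveEnc.inj h.1) (InjectiveEnc.inj h.2)⟩

theorem size_enc_prod (p : α × β) : (enc p).size = (enc p.1).size + (enc p.2).size + 1 := rfl
theorem size_enc_nil : (enc ([] : List α)).size = 1 := rfl
theorem size_enc_cons (a : α) (l : List α) :
    (enc (a :: l)).size = (enc a).size + (enc l).size + 1 := rfl

theorem size_enc_append (l m : List α) :
    (enc (l ++ m)).size + 1 = (enc l).size + (enc m).size := by
  induction l with
  | nil => simp [size_enc_nil]; omega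
  | cons a l ih => simp only [List.cons_append, size_enc_cons]; omega

theorem size_enc_reverse (l : List α) : (enc l.reverse).size = (enc l).size := by
  induction l with
  | nil => rfl
  | cons a l ih =>
    have := size_enc_append l.reverse [a]
    simp only [List.reverse_cons, size_enc_cons, size_enc_nil] at *
    omega

theorem length_lt_size_enc (l : List α) : l.length < (enc l).size := by
  induction l with
  | nil => simp [size_enc_nil]
  | cons a l ih => simp only [List.length_cons, size_enc_cons]; omega

theorem size_enc_lt_of_mem {a : α} {l : List α} (h : a ∈ l) : (enc a).size < (enc l).size := by
  induction l with
  | nil => simp at h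
  | cons b l ih =>
    rw [size_enc_cons]
    rcases List.mem_cons.1 h with rfl | h
    · omega
    · have := ih h; omega

theorem size_enc_le_of_sublist {l m : List α} (h : l.Sublist m) : (enc l).size ≤ (enc m).size := by
  induction h with
  | slnil => exact le_rfl
  | cons a _ ih => rw [size_enc_cons]; omega
  | cons_cons a _ ih => rw [size_enc_cons, size_enc_cons]; omega

theorem size_enc_le_of_forall_mem {l : List α} {N : ℕ} (h : ∀ a ∈ l, (enc a).size ≤ N) :
    (enc l).size ≤ l.length * (N + 1) + 1 := by
  induction l with
  | nil => simp [size_enc_nil]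
  | cons a l ih =>
    have h1 := h a (by simp)
    have h2 := ih fun b hb => h b (by simp [hb])
    rw [size_enc_cons, List.length_cons, add_mul]
    omega

end Encodings

/-- `f` is computed in polynomial time. -/
@[fun_prop]
def PolyTime {α β : Type} [Enc α] [Enc β] (f : α → β) : Prop :=
  Computes (fun a => enc a) (fun a => enc (f a))

namespace PolyTime

variable {α β γ δ : Type} [Enc α] [Enc β] [Enc γ] [Enc δ]

/-- The size of the result is polynomially bounded. -/
theorem exists_size_le {f : α → β} (hf : PolyTime f) :
    ∃ p : Polynomial ℕ, ∀ a, (enc (f a)).size ≤ p.eval (enc a).size := by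
  obtain ⟨P, p, hP⟩ := hf
  refine ⟨p, fun a => ?_⟩
  obtain ⟨t, ht, htp⟩ := hP a
  exact ht.size_le.trans htp

@[fun_prop]
theorem id : PolyTime (fun a : α => a) := Computes.id

@[fun_prop]
theorem const (b : β) : PolyTime (fun _ : α => b) := Computes.const (enc b)

@[fun_prop]
theorem comp {g : β → γ} {f : α → β} (hg : PolyTime g) (hf : PolyTime f) :
    PolyTime (fun a => g (f a)) :=
  Computes.comp hf (hg.reindex f)

@[fun_prop]
theorem prodMk {f : α → β} {g : α → γ} (hf : PolyTime f) (hg : PolyTime g) :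
    PolyTime (fun a => (f a, g a)) :=
  Computes.pair hf hg

@[fun_prop]
theorem fst {f : α → β × γ} (hf : PolyTime f) : PolyTime (fun a => (f a).1) :=
  Computes.comp hf (Computes.instr .fst)

@[fun_prop]
theorem snd {f : α → β × γ} (hf : PolyTime f) : PolyTime (fun a => (f a).2) :=
  Computes.comp hf (Computes.instr .snd)

@[fun_prop]
theorem toValue {f : α → β} (hf : PolyTime f) : PolyTime (fun a => (enc (f a) : Value)) := hf

@[fun_prop]
theorem natAdd {f g : α → ℕ} (hf : PolyTime f) (hg : PolyTime g) :
    PolyTime (fun a => f a + g a) :=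
  (Computes.pair hf hg).comp (Computes.instr .add)

@[fun_prop]
theorem natMul {f g : α → ℕ} (hf : PolyTime f) (hg : PolyTime g) :
    PolyTime (fun a => f a * g a) :=
  (Computes.pair hf hg).comp (Computes.instr .mul)

@[fun_prop]
theorem natDiv {f g : α → ℕ} (hf : PolyTime f) (hg : PolyTime g) :
    PolyTime (fun a => f a / g a) :=
  (Computes.pair hf hg).comp (Computes.instr .div)

@[fun_prop]
theorem decideLT {f g : α → ℕ} (hf : PolyTime f) (hg : PolyTime g) :
    PolyTime (fun a => decide (f a < g a)) := by
  have := (Computes.pair hf hg).comp (Computes.instr .lt)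
  unfold PolyTime
  convert this using 2 with a
  by_cases h : f a < g a <;> simp [enc, Instr.apply, h]

@[fun_prop]
theorem decideEq [DecidableEq β] [InjectiveEnc β] {f g : α → β} (hf : PolyTime f)
    (hg : PolyTime g) : PolyTime (fun a => decide (f a = g a)) := by
  have := (Computes.pair hf hg).comp (Computes.instr .eq)
  unfold PolyTime
  convert this using 2 with a
  by_cases h : f a = g a
  · simp [Instr.apply, h, enc]
  · have h' : enc (f a) ≠ enc (g a) := fun e => h (InjectiveEnc.inj e)
    simp [Instr.apply, h, h']
    rfl

@[fun_prop]
theorem ite {b : α → Bool} {f g : α → β} (hb : PolyTime b) (hf : PolyTime f) (hg : PolyTime g) :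
    PolyTime (fun a => if b a = true then f a else g a) := by
  have := Computes.cond hb hf hg
  unfold PolyTime
  convert this using 2 with a
  have h0 : (enc false : Value) = .nat 0 := rfl
  have h1 : (enc true : Value) ≠ .nat 0 := by simp [enc]
  rcases Bool.eq_false_or_eq_true (b a) with h | h <;> simp only [h, h0, h1, if_true, if_false]
  rfl

@[fun_prop]
theorem bcond {b : α → Bool} {f g : α → β} (hb : PolyTime b) (hf : PolyTime f) (hg : PolyTime g) :
    PolyTime (fun a => bif b a then f a else g a) := by
  simp only [Bool.cond_eq_ite]
  fun_prop

@[fun_prop]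
theorem not {b : α → Bool} (hb : PolyTime b) : PolyTime (fun a => !(b a)) := by
  have : PolyTime (fun a => bif b a then false else true) := by fun_prop
  convert this using 2 with a
  cases b a <;> rfl

@[fun_prop]
theorem and {b c : α → Bool} (hb : PolyTime b) (hc : PolyTime c) :
    PolyTime (fun a => b a && c a) := by
  have : PolyTime (fun a => bif b a then c a else false) := by fun_prop
  convert this using 2 with a
  cases b a <;> rfl

@[fun_prop]
theorem or {b c : α → Bool} (hb : PolyTime b) (hc : PolyTime c) :
    PolyTime (fun a => b a || c a) := by
  have : PolyTime (fun a => bif b a then true else c a) := by fun_prop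
  convert this using 2 with a
  cases b a <;> rfl

@[fun_prop]
theorem cons {f : α → β} {l : α → List β} (hf : PolyTime f) (hl : PolyTime l) :
    PolyTime (fun a => f a :: l a) :=
  Computes.pair hf hl

/-- A loop over a list is polynomial if its body is and if the accumulator stays polynomially
bounded. -/
theorem foldl {l : α → List β} {c : α → γ} {s : α → γ → β → γ} (hl : PolyTime l) (hc : PolyTime c)
    (hs : PolyTime (fun p : α × γ × β => s p.1 p.2.1 p.2.2))
    (hbound : ∃ p : Polynomial ℕ, ∀ a m, m <+: l a →
      (enc (m.foldl (s a) (c a))).size ≤ p.eval (enc a).size) :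
    PolyTime (fun a => (l a).foldl (s a) (c a)) := by
  obtain ⟨b, hb⟩ := hbound
  obtain ⟨pl, hpl⟩ := hl.exists_size_le
  -- the state of the loop consists of the argument, the rest of the list and the accumulator
  obtain ⟨T, pt, hT⟩ : Computes (fun p : α × List β × γ => enc p) (fun p => enc p.2.1) :=
    show PolyTime (fun p : α × List β × γ => p.2.1) by fun_prop
  obtain ⟨B, pb, hB⟩ : Computes
      (fun p : α × (β × List β) × γ => enc (p.1, p.2.1.1 :: p.2.1.2, p.2.2))
      (fun p => enc (p.1, p.2.1.2, s p.1 p.2.2 p.2.1.1)) := by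
    have h : PolyTime (fun p : α × (β × List β) × γ => (p.1, p.2.1.2, s p.1 p.2.2 p.2.1.1)) := by
      have : PolyTime (fun p : α × (β × List β) × γ => s p.1 p.2.2 p.2.1.1) :=
        hs.comp (f := fun p : α × (β × List β) × γ => (p.1, p.2.2, p.2.1.1)) (by fun_prop)
      fun_prop
    exact h
  have key : ∀ (a : α) (N : ℕ) (m : List β) (z : γ),
      (∀ m', m' <+: m → (enc (a, m, m'.foldl (s a) z)).size ≤ N) →
      ∃ t, (Prog.loop T B).Eval (enc (a, m, z)) (enc (a, ([] : List β), m.foldl (s a) z)) t ∧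
        t ≤ (m.length + 1) * (1 + N + pt.eval N + pb.eval N) := by
    intro a N m
    induction m with
    | nil =>
      intro z hz
      obtain ⟨t, ht, htp⟩ := hT (a, [], z)
      have h0 := hz [] (by simp)
      have h1 := pt.eval_mono_nat h0
      simp only [List.foldl_nil] at h0 h1
      dsimp only at htp
      exact ⟨_, Prog.Eval.loop_stop ht, by rw [List.length_nil, zero_add, one_mul]; omega⟩
    | cons x m ih =>
      intro z hz
      obtain ⟨t, ht, htp⟩ := hT (a, x :: m, z)
      obtain ⟨t', ht', htp'⟩ := hB (a, (x, m), z)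
      have h0 := hz [] (by simp)
      simp only [List.foldl_nil] at h0
      have h1 := pt.eval_mono_nat h0
      have h2 := pb.eval_mono_nat h0
      obtain ⟨t'', ht'', hle⟩ := ih (s a z x) fun m' hm' => by
        have := hz (x :: m') (List.cons_prefix_cons.2 ⟨rfl, hm'⟩)
        simp only [List.foldl_cons, size_enc_prod, size_enc_cons] at this ⊢
        omega
      refine ⟨_, .loop_step ht (by simp [enc_cons]) ht' ht'', ?_⟩
      dsimp only [List.length_cons] at hle htp htp' ⊢
      rw [add_mul _ 1]
      omega
  have hloop : Computes (fun a => enc (a, l a, c a))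
      (fun a => enc (a, ([] : List β), (l a).foldl (s a) (c a))) := by
    have hX : ∀ a, (enc a).size ≤ (enc (a, l a, c a)).size := fun a => by
      simp only [size_enc_prod]; omega
    refine ⟨.loop T B, (pl + 1) * (1 + (Polynomial.X + pl + b + 2) +
      pt.comp (Polynomial.X + pl + b + 2) + pb.comp (Polynomial.X + pl + b + 2)), fun a => ?_⟩
    obtain ⟨t, ht, hle⟩ := key a ((Polynomial.X + pl + b + 2).eval (enc a).size) (l a) (c a)
      fun m hm => by
        have h1 := hb a m hm
        have h2 := hpl a
        simp only [size_enc_prod, Polynomial.eval_add, Polynomial.eval_X, Polynomial.eval_ofNat]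
        omega
    refine ⟨t, ht, hle.trans (le_trans ?_ (Polynomial.eval_mono_nat _ (hX a)))⟩
    rw [Polynomial.eval_mul]
    refine Nat.mul_le_mul ?_ ?_
    · have h1 := hpl a
      have h2 := length_lt_size_enc (l a)
      simp only [Polynomial.eval_add, Polynomial.eval_one]
      omega
    · simp only [Polynomial.eval_add, Polynomial.eval_one, Polynomial.eval_comp]
      exact le_rfl
  have h1 : Computes (fun a => enc a) (fun a => enc (a, l a, c a)) :=
    show PolyTime (fun a => (a, l a, c a)) by fun_prop
  exact (h1.comp hloop).comp ((Computes.instr .snd).comp (Computes.instr .snd))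

end PolyTime

namespace PolyTime

variable {α β γ δ : Type} [Enc α] [Enc β] [Enc γ] [Enc δ]

@[fun_prop]
theorem listReverse {l : α → List β} (hl : PolyTime l) : PolyTime (fun a => (l a).reverse) := by
  have h := hl.foldl (c := fun _ => ([] : List β)) (s := fun _ acc x => x :: acc) (by fun_prop)
    (by fun_prop) (by
      obtain ⟨p, hp⟩ := hl.exists_size_le
      refine ⟨p, fun a m hm => ?_⟩
      rw [List.foldl_flip_cons_eq_append', List.append_nil, size_enc_reverse]
      exact (size_enc_le_of_sublist hm.sublist).trans (hp a))
  simpa using h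

@[fun_prop]
theorem listAppend {l m : α → List β} (hl : PolyTime l) (hm : PolyTime m) :
    PolyTime (fun a => l a ++ m a) := by
  have h := hl.listReverse.foldl (c := m) (s := fun _ acc x => x :: acc) hm
    (by fun_prop) (by
      obtain ⟨p, hp⟩ := hl.exists_size_le
      obtain ⟨q, hq⟩ := hm.exists_size_le
      refine ⟨p + q, fun a k hk => ?_⟩
      rw [List.foldl_flip_cons_eq_append']
      have h1 := size_enc_append k.reverse (m a)
      have h2 := size_enc_le_of_sublist hk.sublist
      rw [size_enc_reverse] at h1 h2
      have h3 := hp a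
      have h4 := hq a
      rw [Polynomial.eval_add]
      omega)
  simpa using h

@[fun_prop]
theorem listFlatMap {l : α → List β} {f : α → β → List γ} (hl : PolyTime l)
    (hf : PolyTime (fun p : α × β => f p.1 p.2)) : PolyTime (fun a => (l a).flatMap (f a)) := by
  have hfold : ∀ (a : α) (m : List β) (z : List γ),
      m.foldl (fun acc x => acc ++ f a x) z = z ++ m.flatMap (f a) := by
    intro a m
    induction m with
    | nil => simp
    | cons x m ih => intro z; simp [ih]
  have h := hl.foldl (c := fun _ => ([] : List γ)) (s := fun a acc x => acc ++ f a x) (by fun_prop)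
    (by
      have : PolyTime (fun p : α × List γ × β => f p.1 p.2.2) :=
        hf.comp (f := fun p : α × List γ × β => (p.1, p.2.2)) (by fun_prop)
      fun_prop)
    (by
      obtain ⟨p, hp⟩ := hl.exists_size_le
      obtain ⟨q, hq⟩ := hf.exists_size_le
      refine ⟨p * q.comp (Polynomial.X + p + 1) + 1, fun a m hm => ?_⟩
      rw [hfold, List.nil_append]
      simp only [Polynomial.eval_add, Polynomial.eval_mul, Polynomial.eval_comp,
        Polynomial.eval_X, Polynomial.eval_one]
      have hx : ∀ x ∈ m, (enc (f a x)).size ≤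
          q.eval ((enc a).size + p.eval (enc a).size + 1) := fun x hx => by
        refine (hq (a, x)).trans (q.eval_mono_nat ?_)
        have h1 := (size_enc_lt_of_mem (hm.subset hx)).le.trans (hp a)
        rw [size_enc_prod]
        dsimp only
        omega
      have hlen : m.length ≤ p.eval (enc a).size :=
        hm.length_le.trans ((length_lt_size_enc _).le.trans (hp a))
      have : (enc (m.flatMap (f a))).size ≤
          m.length * q.eval ((enc a).size + p.eval (enc a).size + 1) + 1 := by
        clear hm hlen
        induction m with
        | nil => simp [size_enc_nil]
        | cons x m ih =>
          have h1 := hx x (by simp)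
          have h2 := ih fun y hy => hx y (by simp [hy])
          have h3 := size_enc_append (f a x) (m.flatMap (f a))
          rw [List.flatMap_cons, List.length_cons, add_mul]
          omega
      refine this.trans ?_
      gcongr)
  simpa [hfold] using h

@[fun_prop]
theorem listMap {l : α → List β} {f : α → β → γ} (hl : PolyTime l)
    (hf : PolyTime (fun p : α × β => f p.1 p.2)) : PolyTime (fun a => (l a).map (f a)) := by
  have h : PolyTime (fun a => (l a).flatMap (fun b => [f a b])) := by fun_prop
  simpa only [List.map_eq_flatMap] using h

@[fun_prop]
theorem listFilter {l : α → List β} {f : α → β → Bool} (hl : PolyTime l)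
    (hf : PolyTime (fun p : α × β => f p.1 p.2)) : PolyTime (fun a => (l a).filter (f a)) := by
  have h : PolyTime (fun a => (l a).flatMap (fun b => if f a b = true then [b] else [])) := by
    fun_prop
  convert h using 2 with a
  induction l a with
  | nil => rfl
  | cons x m ih => rw [List.flatMap_cons, ← ih, List.filter_cons]; split_ifs <;> rfl

theorem size_enc_bool_le (b : Bool) : (enc b).size ≤ 2 := by
  cases b <;> simp [enc, Value.size]

@[fun_prop]
theorem listAny {l : α → List β} {f : α → β → Bool} (hl : PolyTime l)
    (hf : PolyTime (fun p : α × β => f p.1 p.2)) : PolyTime (fun a => (l a).any (f a)) := by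
  have h := hl.foldl (c := fun _ => false) (s := fun a acc x => acc || f a x) (by fun_prop)
    (by
      have : PolyTime (fun p : α × Bool × β => f p.1 p.2.2) :=
        hf.comp (f := fun p : α × Bool × β => (p.1, p.2.2)) (by fun_prop)
      fun_prop)
    ⟨2, fun a m _ => by simpa using size_enc_bool_le _⟩
  have hfold : ∀ (a : α) (m : List β) (z : Bool),
      m.foldl (fun acc x => acc || f a x) z = (z || m.any (f a)) := by
    intro a m
    induction m with
    | nil => simp
    | cons x m ih => intro z; simp [ih, Bool.or_assoc]
  simpa [hfold] using h

@[fun_prop]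
theorem listAll {l : α → List β} {f : α → β → Bool} (hl : PolyTime l)
    (hf : PolyTime (fun p : α × β => f p.1 p.2)) : PolyTime (fun a => (l a).all (f a)) := by
  have h : PolyTime (fun a => !((l a).any (fun b => !(f a b)))) := by fun_prop
  simpa [List.not_any_eq_all_not] using h

@[fun_prop]
theorem listMem [BEq β] [LawfulBEq β] [InjectiveEnc β] {l : α → List β} {f : α → β}
    (hf : PolyTime f) (hl : PolyTime l) : PolyTime (fun a => decide (f a ∈ l a)) := by
  let _ : DecidableEq β := Classical.decEq β
  have h : PolyTime (fun a => (l a).any (fun b => decide (b = f a))) := by fun_prop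
  convert h using 2 with a
  rw [Bool.eq_iff_iff]
  simp

@[fun_prop]
theorem listLength {l : α → List β} (hl : PolyTime l) : PolyTime (fun a => (l a).length) := by
  have h := hl.foldl (c := fun _ => 0) (s := fun _ acc _ => acc + 1) (by fun_prop)
    (by fun_prop) (by
      obtain ⟨p, hp⟩ := hl.exists_size_le
      refine ⟨p + 1, fun a m hm => ?_⟩
      have h1 := hm.length_le.trans ((length_lt_size_enc _).le.trans (hp a))
      have h2 : Nat.size m.length ≤ m.length := Nat.size_le.2 Nat.lt_two_pow_self
      simp only [List.foldl_add_const, zero_add, one_mul, enc_nat, Value.size,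
        Polynomial.eval_add, Polynomial.eval_one]
      omega)
  simpa using h

/-- The product of a list of numbers: the sizes of the factors add up. -/
@[fun_prop]
theorem listProd {l : α → List ℕ} (hl : PolyTime l) : PolyTime (fun a => (l a).prod) := by
  have h := hl.foldl (c := fun _ => 1) (s := fun _ acc x => acc * x) (by fun_prop)
    (by fun_prop) (by
      obtain ⟨p, hp⟩ := hl.exists_size_le
      refine ⟨p + 1, fun a m hm => ?_⟩
      have h2 := (size_enc_le_of_sublist hm.sublist).trans (hp a)
      have h3 : Nat.size m.prod ≤ (enc m).size := by
        clear hm h2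
        induction m with
        | nil => simp [size_enc_nil]
        | cons x m ih =>
          have := Nat.size_mul_le x m.prod
          rw [List.prod_cons, size_enc_cons, enc_nat, Value.size]
          omega
      have h4 : m.foldl (fun acc x => acc * x) 1 = m.prod := by
        rw [List.prod_eq_foldl]
      rw [h4, enc_nat, Value.size, Polynomial.eval_add, Polynomial.eval_one]
      omega)
  convert h using 2 with a
  rw [List.prod_eq_foldl]

end PolyTime

/-! ### Paths and arborescences -/

section Paths

variable {V : Type}

theorem Reaches.mono {E F : Finset (V × V)} (h : E ⊆ F) {u v : V} (huv : Reaches E u v) :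
    Reaches F u v :=
  Relation.ReflTransGen.mono (fun _ _ hxy => h hxy) _ _ huv

/-- A path that leaves a set does so along some arc. -/
theorem Relation.ReflTransGen.exists_exit {R : V → V → Prop} {a b : V}
    (h : Relation.ReflTransGen R a b) {U : Set V} (ha : a ∈ U) (hb : b ∉ U) :
    ∃ p z, p ∈ U ∧ z ∉ U ∧ R p z ∧ Relation.ReflTransGen R z b := by
  induction h using Relation.ReflTransGen.head_induction_on with
  | refl => exact absurd ha hb
  | @head a c hac hcb ih =>
    by_cases hc : c ∈ U
    · exact ih hc
    · exact ⟨a, c, ha, hc, hac, hcb⟩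

/-- The arcs that do not enter `v`. -/
def arcsAvoiding [DecidableEq V] (E : Finset (V × V)) (v : V) : Finset (V × V) :=
  E.filter fun a => a.2 ≠ v

theorem Reaches.avoiding_or [DecidableEq V] {E : Finset (V × V)} {a b : V} (h : Reaches E a b)
    (v : V) : Reaches (arcsAvoiding E v) a b ∨
      Relation.TransGen (fun x y => (x, y) ∈ E) a v ∧ Reaches E v b := by
  induction h with
  | refl => exact .inl .refl
  | @tail c d hac hcd ih =>
    rcases ih with h | ⟨h, h'⟩
    · by_cases hd : d = v
      · subst hd
        exact .inr ⟨.tail' hac hcd, .refl⟩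
      · exact .inl (h.tail (Finset.mem_filter.2 ⟨hcd, hd⟩))
    · exact .inr ⟨h, h'.tail hcd⟩

theorem IsTreeRootedAt.not_transGen_self {r : V} {F : Finset (V × V)} (hF : IsTreeRootedAt r F)
    {v : V} (hv : Reaches F r v) : ¬ Relation.TransGen (fun x y => (x, y) ∈ F) v v := by
  induction hv with
  | refl =>
    intro h
    obtain ⟨z, _, hz⟩ := Relation.TransGen.tail'_iff.1 h
    exact hF.root_no_entering _ hz rfl
  | @tail x y _ hxy ih =>
    intro h
    obtain ⟨z, hyz, hz⟩ := Relation.TransGen.tail'_iff.1 h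
    obtain rfl : z = x := congrArg Prod.fst (hF.entering_unique _ hz _ hxy rfl)
    exact ih (.head' hxy hyz)

/-- Every finite digraph contains a tree that spans all vertices reachable from the root. -/
theorem exists_spanning_tree (r : V) (E : Finset (V × V)) :
    ∃ F ⊆ E, IsTreeRootedAt r F ∧ ∀ v, Reaches E r v → Reaches F r v := by
  classical
  obtain ⟨F, hF, hmax⟩ := Finset.exists_max_image (E.powerset.filter (IsTreeRootedAt r)) Finset.card
    ⟨∅, by simpa using ⟨by simp, by simp, by simp⟩⟩
  rw [Finset.mem_filter, Finset.mem_powerset] at hF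
  obtain ⟨hFE, hF⟩ := hF
  refine ⟨F, hFE, hF, fun v hv => ?_⟩
  by_contra hvF
  obtain ⟨p, z, hp, hz, hpz, -⟩ :=
    Relation.ReflTransGen.exists_exit (U := {x | Reaches F r x}) hv .refl hvF
  -- a larger tree
  have hsub : F ⊆ insert (p, z) F := Finset.subset_insert _ _
  have hnew : ∀ a ∈ F, a.2 ≠ z := by
    rintro ⟨a, b⟩ ha rfl
    exact hz ((hF.reachable _ ha).tail ha)
  have htree : IsTreeRootedAt r (insert (p, z) F) := by
    refine ⟨fun a ha => ?_, fun a ha b hb hab => ?_, fun a ha => ?_⟩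
    · rcases Finset.mem_insert.1 ha with rfl | ha
      · rintro rfl
        exact hz .refl
      · exact hF.root_no_entering a ha
    · rcases Finset.mem_insert.1 ha with rfl | ha <;> rcases Finset.mem_insert.1 hb with rfl | hb
      · rfl
      · exact absurd hab.symm (hnew b hb)
      · exact absurd hab (hnew a ha)
      · exact hF.entering_unique a ha b hb hab
    · rcases Finset.mem_insert.1 ha with rfl | ha
      · exact Reaches.mono hsub hp
      · exact (hF.reachable a ha).mono hsub
  have hle := hmax (insert (p, z) F) (Finset.mem_filter.2
    ⟨Finset.mem_powerset.2 (Finset.insert_subset hpz hFE), htree⟩)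
  rw [Finset.card_insert_of_notMem (fun h => hnew _ h rfl)] at hle
  omega

end Paths

/-! ### Two disjoint paths -/

section Menger

variable {V : Type}

open Relation

/-- An arc of `E` whose head lies in `X`. -/
def StepIn (E : Finset (V × V)) (X : Set V) (x y : V) : Prop := (x, y) ∈ E ∧ y ∈ X

/-- Some path of `E` inside `X` leads from `A` to `B`. -/
def Joins (E : Finset (V × V)) (X A B : Set V) : Prop :=
  ∃ a ∈ A, ∃ b ∈ B, a ∈ X ∧ ReflTransGen (StepIn E X) a b

theorem StepIn.reflTransGen_mono {E F : Finset (V × V)} {X Y : Set V} (hE : E ⊆ F) (hX : X ⊆ Y)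
    {a b : V} (h : ReflTransGen (StepIn E X) a b) : ReflTransGen (StepIn F Y) a b :=
  ReflTransGen.mono (fun _ _ h => ⟨hE h.1, hX h.2⟩) _ _ h

theorem Joins.mono {E F : Finset (V × V)} {X A B : Set V} (hE : E ⊆ F)
    (h : Joins E X A B) : Joins F X A B := by
  obtain ⟨a, ha, b, hb, haX, hab⟩ := h
  exact ⟨a, ha, b, hb, haX, StepIn.reflTransGen_mono hE le_rfl hab⟩

theorem StepIn.mem_of_reflTransGen {E : Finset (V × V)} {X : Set V} {a b : V}
    (h : ReflTransGen (StepIn E X) a b) (ha : a ∈ X) : b ∈ X := by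
  induction h with
  | refl => exact ha
  | tail _ h _ => exact h.2

/-- A path either avoids `s` or passes through it. -/
theorem Joins.avoid_or {E : Finset (V × V)} {X A B : Set V} (h : Joins E X A B) (s : V) :
    Joins E {s}ᶜ A B ∨ Joins E X A {s} ∧ Joins E X {s} B := by
  obtain ⟨a, ha, b, hb, haX, hab⟩ := h
  suffices a ≠ s ∧ ReflTransGen (StepIn E {s}ᶜ) a b ∨
      ReflTransGen (StepIn E X) a s ∧ s ∈ X ∧ ReflTransGen (StepIn E X) s b by
    rcases this with ⟨h1, h2⟩ | ⟨h1, h2, h3⟩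
    · exact .inl ⟨a, ha, b, hb, h1, h2⟩
    · exact .inr ⟨⟨a, ha, s, rfl, haX, h1⟩, ⟨s, rfl, b, hb, h2, h3⟩⟩
  clear hb
  induction hab with
  | refl =>
    by_cases has : a = s
    · subst has; exact .inr ⟨.refl, haX, .refl⟩
    · exact .inl ⟨has, .refl⟩
  | @tail c d hac hcd ih =>
    rcases ih with ⟨h1, h2⟩ | ⟨h1, h2, h3⟩
    · by_cases hd : d = s
      · subst hd; exact .inr ⟨hac.tail hcd, hcd.2, .refl⟩
      · exact .inl ⟨h1, h2.tail ⟨hcd.1, hd⟩⟩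
    · exact .inr ⟨h1, h2, h3.tail hcd⟩

/-- A path either avoids an arc or decomposes along it. -/
theorem Joins.of_insert [DecidableEq V] {E : Finset (V × V)} {X A B : Set V} {x y : V}
    (h : Joins (insert (x, y) E) X A B) :
    Joins E X A B ∨ Joins E X A {x} ∧ Joins E X {y} B := by
  obtain ⟨a, ha, b, hb, haX, hab⟩ := h
  suffices ReflTransGen (StepIn E X) a b ∨
      ReflTransGen (StepIn E X) a x ∧ y ∈ X ∧ ReflTransGen (StepIn E X) y b by
    rcases this with h1 | ⟨h1, h2, h3⟩
    · exact .inl ⟨a, ha, b, hb, haX, h1⟩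
    · exact .inr ⟨⟨a, ha, x, rfl, haX, h1⟩, ⟨y, rfl, b, hb, h2, h3⟩⟩
  clear hb
  induction hab with
  | refl => exact .inl .refl
  | @tail c d hac hcd ih =>
    obtain ⟨hcd, hd⟩ := hcd
    rcases Finset.mem_insert.1 hcd with heq | hcd
    · obtain ⟨rfl, rfl⟩ := Prod.mk.injEq _ _ _ _ ▸ heq
      rcases ih with h1 | ⟨h1, h2, h3⟩
      · exact .inr ⟨h1, hd, .refl⟩
      · exact .inr ⟨h1, hd, .refl⟩
    · rcases ih with h1 | ⟨h1, h2, h3⟩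
      · exact .inl (h1.tail ⟨hcd, hd⟩)
      · exact .inr ⟨h1, h2, h3.tail ⟨hcd, hd⟩⟩

theorem Joins.union_right {E : Finset (V × V)} {X A B B' : Set V} :
    Joins E X A (B ∪ B') ↔ Joins E X A B ∨ Joins E X A B' := by
  constructor
  · rintro ⟨a, ha, b, hb | hb, h⟩
    · exact .inl ⟨a, ha, b, hb, h⟩
    · exact .inr ⟨a, ha, b, hb, h⟩
  · rintro (⟨a, ha, b, hb, h⟩ | ⟨a, ha, b, hb, h⟩)
    · exact ⟨a, ha, b, .inl hb, h⟩
    · exact ⟨a, ha, b, .inr hb, h⟩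

theorem Joins.union_left {E : Finset (V × V)} {X A A' B : Set V} :
    Joins E X (A ∪ A') B ↔ Joins E X A B ∨ Joins E X A' B := by
  constructor
  · rintro ⟨a, ha | ha, h⟩
    · exact .inl ⟨a, ha, h⟩
    · exact .inr ⟨a, ha, h⟩
  · rintro (⟨a, ha, h⟩ | ⟨a, ha, h⟩)
    · exact ⟨a, .inl ha, h⟩
    · exact ⟨a, .inr ha, h⟩

theorem Joins.mem_right {E : Finset (V × V)} {X A : Set V} {s : V} (h : Joins E X A {s}) :
    s ∈ X := by
  obtain ⟨a, _, b, rfl, haX, hab⟩ := h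
  exact StepIn.mem_of_reflTransGen hab haX

theorem Joins.mem_left {E : Finset (V × V)} {X B : Set V} {s : V} (h : Joins E X {s} B) :
    s ∈ X := by
  obtain ⟨a, rfl, _, _, haX, _⟩ := h
  exact haX

/-- Two disjoint paths ending in `{s, x}` have distinct ends. -/
theorem exists_joins_ends {E : Finset (V × V)} {A : Set V} {s x : V}
    (h : ∃ X, Joins E X A ({s} ∪ {x}) ∧ Joins E Xᶜ A ({s} ∪ {x})) :
    ∃ X, Joins E X A {s} ∧ Joins E Xᶜ A {x} := by
  obtain ⟨X, h1, h2⟩ := h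
  rw [Joins.union_right] at h1 h2
  rcases h1 with h1 | h1 <;> rcases h2 with h2 | h2
  · exact absurd h1.mem_right h2.mem_right
  · exact ⟨X, h1, h2⟩
  · exact ⟨Xᶜ, h2, by rwa [compl_compl]⟩
  · exact absurd h1.mem_right h2.mem_right

theorem exists_joins_starts {E : Finset (V × V)} {B : Set V} {s y : V}
    (h : ∃ X, Joins E X ({s} ∪ {y}) B ∧ Joins E Xᶜ ({s} ∪ {y}) B) :
    ∃ X, Joins E X {s} B ∧ Joins E Xᶜ {y} B := by
  obtain ⟨X, h1, h2⟩ := h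
  rw [Joins.union_left] at h1 h2
  rcases h1 with h1 | h1 <;> rcases h2 with h2 | h2
  · exact absurd h1.mem_left h2.mem_left
  · exact ⟨X, h1, h2⟩
  · exact ⟨Xᶜ, h2, by rwa [compl_compl]⟩
  · exact absurd h1.mem_left h2.mem_left

/-- Menger's theorem for two vertex-disjoint paths: if no vertex meets all paths from `A` to `B`,
there are two disjoint such paths (one inside `X`, the other one outside). The induction deletes
an arc `(x, y)`; if a vertex `s` then meets all paths, two paths from `A` to `{s, x}` and two paths
from `{s, y}` to `B` fit together. -/
theorem exists_disjoint_joins [Nonempty V] (E : Finset (V × V)) :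
    ∀ A B : Set V, (∀ v, Joins E {v}ᶜ A B) → ∃ X, Joins E X A B ∧ Joins E Xᶜ A B := by
  classical
  induction E using Finset.induction_on with
  | empty =>
    intro A B h
    have key : ∀ v, ∃ a ∈ A, a ∈ B ∧ a ≠ v := by
      intro v
      obtain ⟨a, ha, b, hb, hav, hab⟩ := h v
      cases hab with
      | refl => exact ⟨a, ha, hb, hav⟩
      | tail _ h => exact absurd h.1 (by simp)
    obtain ⟨a, haA, haB, -⟩ := key (Classical.arbitrary V)
    obtain ⟨b, hbA, hbB, hba⟩ := key a
    exact ⟨{a}, ⟨a, haA, a, haB, rfl, .refl⟩, ⟨b, hbA, b, hbB, hba, .refl⟩⟩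
  | insert e E he ih =>
    obtain ⟨x, y⟩ := e
    intro A B h
    have hsub : E ⊆ insert (x, y) E := Finset.subset_insert _ _
    by_cases hE : ∀ v, Joins E {v}ᶜ A B
    · obtain ⟨X, h1, h2⟩ := ih A B hE
      exact ⟨X, h1.mono hsub, h2.mono hsub⟩
    push Not at hE
    obtain ⟨s, hs⟩ := hE
    obtain ⟨X, hX1, hX2⟩ : ∃ X, Joins E X A {s} ∧ Joins E Xᶜ A {x} := by
      refine exists_joins_ends (ih A _ fun v => Joins.union_right.2 ?_)
      rcases (h v).of_insert with h1 | ⟨h1, -⟩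
      · exact .inl ((h1.avoid_or s).resolve_left hs).1
      · exact .inr h1
    obtain ⟨Y, hY1, hY2⟩ : ∃ Y, Joins E Y {s} B ∧ Joins E Yᶜ {y} B := by
      refine exists_joins_starts (ih _ B fun v => Joins.union_left.2 ?_)
      rcases (h v).of_insert with h1 | ⟨-, h1⟩
      · exact .inl ((h1.avoid_or s).resolve_left hs).2
      · exact .inr h1
    have hsX := hX1.mem_right
    have hsY := hY1.mem_left
    -- what `A` reaches and what reaches `B` without passing through `s`
    set M : Set V := {z | ∃ a ∈ A, a ≠ s ∧ ReflTransGen (StepIn E {s}ᶜ) a z} with hM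
    set N : Set V := {z | z ≠ s ∧ ∃ b ∈ B, ReflTransGen (StepIn E {s}ᶜ) z b} with hN
    have hMs : ∀ z ∈ M, z ≠ s := by
      rintro z ⟨a, -, has, haz⟩
      exact StepIn.mem_of_reflTransGen (X := {s}ᶜ) haz has
    have hMN : ∀ z ∈ M, z ∉ N := by
      rintro z ⟨a, ha, has, haz⟩ ⟨-, b, hb, hzb⟩
      exact hs ⟨a, ha, b, hb, has, haz.trans hzb⟩
    have hMstep : ∀ {z z'}, z ∈ M → (z, z') ∈ E → z' ≠ s → z' ∈ M := by
      rintro z z' ⟨a, ha, has, haz⟩ hzz' hz'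
      exact ⟨a, ha, has, haz.tail ⟨hzz', hz'⟩⟩
    have hNstep : ∀ {z z'}, z' ∈ N → (z, z') ∈ E → z ≠ s → z ∈ N := by
      rintro z z' ⟨hz', b, hb, hzb⟩ hzz' hz
      exact ⟨hz, b, hb, hzb.head ⟨hzz', hz'⟩⟩
    refine ⟨insert s (X ∩ M ∪ Y ∩ N), ?_, ?_⟩
    · obtain ⟨a, ha, _, rfl, haX, has⟩ := hX1
      obtain ⟨_, rfl, b, hb, -, hsb⟩ := hY1
      rename_i s
      set Z := insert s (X ∩ M ∪ Y ∩ N)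
      have hsZ : s ∈ Z := Set.mem_insert _ _
      have h1 : a ∈ Z ∧ ReflTransGen (StepIn E Z) a s := by
        by_cases hne : a = s
        · subst hne; exact ⟨hsZ, .refl⟩
        have haM : a ∈ M := ⟨a, ha, hne, .refl⟩
        refine ⟨.inr (.inl ⟨haX, haM⟩), ?_⟩
        have : ∀ z, ReflTransGen (StepIn E X) a z → ReflTransGen (StepIn E Z) a s ∨
            z ∈ M ∧ ReflTransGen (StepIn E Z) a z := by
          intro z hz
          induction hz with
          | refl => exact .inr ⟨haM, .refl⟩
          | @tail c d _ hcd ih =>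
            rcases ih with ih | ⟨hc, ih⟩
            · exact .inl ih
            by_cases hd : d = s
            · subst hd; exact .inl (ih.tail ⟨hcd.1, hsZ⟩)
            · have hdM := hMstep hc hcd.1 hd
              exact .inr ⟨hdM, ih.tail ⟨hcd.1, .inr (.inl ⟨hcd.2, hdM⟩)⟩⟩
        exact (this s has).elim id And.right
      have h2 : ReflTransGen (StepIn E Z) s b := by
        have : ∀ z, z ∈ Y → ReflTransGen (StepIn E Y) z b → ReflTransGen (StepIn E Z) s b ∨
            z ∈ N ∧ ReflTransGen (StepIn E Z) z b := by
          intro z hzY hz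
          induction hz using ReflTransGen.head_induction_on with
          | refl =>
            by_cases hbs : b = s
            · rw [hbs]; exact .inl .refl
            · exact .inr ⟨⟨hbs, b, hb, .refl⟩, .refl⟩
          | @head c d hcd _ ih =>
            rcases ih hcd.2 with ih | ⟨hd, ih⟩
            · exact .inl ih
            have hcb : ReflTransGen (StepIn E Z) c b := ih.head ⟨hcd.1, .inr (.inr ⟨hcd.2, hd⟩)⟩
            by_cases hc : c = s
            · subst hc; exact .inl hcb
            · exact .inr ⟨hNstep hd hcd.1 hc, hcb⟩
        exact (this s hsY hsb).elim id And.right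
      exact ⟨a, ha, b, hb, h1.1, StepIn.reflTransGen_mono hsub le_rfl (h1.2.trans h2)⟩
    · obtain ⟨a, ha, _, rfl, haX, hax⟩ := hX2
      obtain ⟨_, rfl, b, hb, hyY, hyb⟩ := hY2
      rename_i x y
      set Z := insert s (X ∩ M ∪ Y ∩ N)
      have hXM : ∀ z ∈ Xᶜ, z ∈ M → z ∈ Zᶜ := by
        rintro z hz hzM (rfl | ⟨h, -⟩ | ⟨-, h⟩)
        · exact hz hsX
        · exact hz h
        · exact hMN z hzM h
      have hYN : ∀ z ∈ Yᶜ, z ∈ N → z ∈ Zᶜ := by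
        rintro z hz hzN (rfl | ⟨-, h⟩ | ⟨h, -⟩)
        · exact hz hsY
        · exact hMN z h hzN
        · exact hz h
      have haM : a ∈ M := ⟨a, ha, fun h => haX (h ▸ hsX), .refl⟩
      have h1 : x ∈ M ∧ ReflTransGen (StepIn E Zᶜ) a x := by
        clear * - hax haM hMstep hXM hsX
        induction hax with
        | refl => exact ⟨haM, .refl⟩
        | @tail c d _ hcd ih =>
          have hd := hMstep ih.1 hcd.1 (fun h => hcd.2 (h ▸ hsX))
          exact ⟨hd, ih.2.tail ⟨hcd.1, hXM d hcd.2 hd⟩⟩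
      have h2 : y ∈ N ∧ ReflTransGen (StepIn E Zᶜ) y b := by
        clear * - hyb hyY hNstep hYN hsY hN hb
        induction hyb using ReflTransGen.head_induction_on with
        | refl => exact ⟨⟨fun h => hyY (h ▸ hsY), b, hb, .refl⟩, .refl⟩
        | @head c d hcd _ ih =>
          obtain ⟨hd, hdb⟩ := ih hcd.2
          exact ⟨hNstep hd hcd.1 (fun h => hyY (h ▸ hsY)), hdb.head ⟨hcd.1, hYN d hcd.2 hd⟩⟩
      refine ⟨a, ha, b, hb, hXM a haX haM, ?_⟩
      refine (StepIn.reflTransGen_mono hsub le_rfl h1.2).trans (.head ⟨?_, hYN y hyY h2.1⟩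
        (StepIn.reflTransGen_mono hsub le_rfl h2.2))
      exact Finset.mem_insert_self _ _

end Menger

/-! ### Feasible trees -/

section Feasible

variable {V : Type}

open Relation

/-- `F` is a tree rooted at `r` that spans `T`, and only arcs of `G` carry all of `T`. If all
capacities are at least `K - 1` and `G` consists of the arcs of capacity at least `K`, where `K` is
the cardinality of `T`, these are the feasible solutions. -/
structure IsFeasibleTree (r : V) (T : Finset V) (G F : Finset (V × V)) : Prop where
  tree : IsTreeRootedAt r F
  spans : ∀ t ∈ T, Reaches F r t
  mem_of_carries : ∀ a ∈ F, (∀ t ∈ T, Reaches F a.2 t) → a ∈ G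

variable {r : V} {T : Finset V} {G E : Finset (V × V)}

/-- A spanning tree of `D` is feasible if no arc of `D` outside `G` carries all terminals. -/
theorem exists_isFeasibleTree_of_subset {D : Finset (V × V)} (hDE : D ⊆ E)
    (hD : ∀ t ∈ T, Reaches D r t) (hG : ∀ a ∈ D, (∀ t ∈ T, Reaches D a.2 t) → a ∈ G) :
    ∃ F ⊆ E, IsFeasibleTree r T G F := by
  obtain ⟨F, hFD, htree, hspan⟩ := exists_spanning_tree r D
  exact ⟨F, hFD.trans hDE, htree, fun t ht => hspan t (hD t ht),
    fun a ha h => hG a (hFD ha) fun t ht => (h t ht).mono hFD⟩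

theorem mem_of_reaches {D : Finset (V × V)} {U : Set V} {x y : V}
    (h : Reaches D x y) (hy : y ∈ U) (hU : ∀ a ∈ D, a.2 ∈ U → a.1 ∈ U) : x ∈ U := by
  induction h using ReflTransGen.head_induction_on with
  | refl => exact hy
  | @head a c hac _ ih => exact hU _ hac ih

/-- If the subtree at `v` contains all terminals, then so do the subtrees at all vertices of the
path to `v`. -/
theorem IsFeasibleTree.reaches_of_carries {F : Finset (V × V)} (hF : IsFeasibleTree r T G F)
    {v : V} (hrv : Reaches F r v) (hv : ∀ t ∈ T, Reaches F v t) :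
    ReflTransGen (fun x y => (x, y) ∈ F ∧ (x, y) ∈ G ∧ ∀ t ∈ T, Reaches F y t) r v := by
  have hmem := hF.mem_of_carries
  clear hF
  induction hrv using ReflTransGen.head_induction_on with
  | refl => exact .refl
  | @head a c hac hcv ih =>
    have hc : ∀ t ∈ T, Reaches F c t := fun t ht => ReflTransGen.trans hcv (hv t ht)
    exact .head ⟨hac, hmem _ hac hc, hc⟩ ih

/-- The root reaches every terminal, and a vertex that cannot be reached by arcs of `G` does not
separate the root from all terminals. -/
def NoBottleneck [DecidableEq V] (r : V) (T : Finset V) (G E : Finset (V × V)) : Prop :=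
  (∀ t ∈ T, Reaches E r t) ∧
    ∀ v, ¬ Reaches (E ∩ G) r v → ∃ t ∈ T, Reaches (arcsAvoiding E v) r t

variable [DecidableEq V]

theorem IsFeasibleTree.noBottleneck {F : Finset (V × V)} (hF : IsFeasibleTree r T G F)
    (hFE : F ⊆ E) (hT : T.Nonempty) : NoBottleneck r T G E := by
  refine ⟨fun t ht => (hF.spans t ht).mono hFE, fun v hv => ?_⟩
  by_contra! hsep
  have hsep' : ∀ t ∈ T, TransGen (fun x y => (x, y) ∈ F) r v ∧ Reaches F v t := fun t ht =>
    ((hF.spans t ht).avoiding_or v).resolve_left fun h =>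
      hsep t ht (h.mono (Finset.filter_subset_filter _ hFE))
  obtain ⟨t, ht⟩ := hT
  have hrv := (hsep' t ht).1.to_reflTransGen
  exact hv (ReflTransGen.mono (fun x y h => Finset.mem_inter.2 ⟨hFE h.1, h.2.1⟩) _ _
    (hF.reaches_of_carries hrv fun t ht => (hsep' t ht).2))

/-- The criterion for feasibility. Let `W` be the set of the vertices that can be reached by arcs of
`G`. Unless `W` contains a terminal, there are two disjoint paths from `W` to terminals; the tree is
chosen such that its subtrees at the vertices outside `W` meet at most one of these paths. -/
theorem NoBottleneck.exists_isFeasibleTree (hT : T.Nonempty) (h : NoBottleneck r T G E) :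
    ∃ F ⊆ E, IsFeasibleTree r T G F := by
  classical
  obtain ⟨hspan, hsep⟩ := h
  set W : Set V := {v | Reaches (E ∩ G) r v} with hW
  have hrW : r ∈ W := .refl
  by_cases hWT : ∃ t ∈ T, t ∈ W
  · obtain ⟨w, hwT, hw⟩ := hWT
    set D := E.filter fun a => a.2 ∈ W → a ∈ G ∧ a.1 ∈ W with hDdef
    have hDW : ∀ v ∈ W, Reaches D r v := by
      intro v hv
      have : Reaches (E ∩ G) r v := hv
      induction this with
      | refl => exact .refl
      | @tail a b hra hab ih =>
        have hab' := Finset.mem_inter.1 hab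
        exact (ih hra).tail (Finset.mem_filter.2 ⟨hab'.1, fun _ => ⟨hab'.2, hra⟩⟩)
    have hD : ∀ v, Reaches E r v → Reaches D r v := by
      intro v hv
      induction hv with
      | refl => exact .refl
      | @tail a b _ hab ih =>
        by_cases hb : b ∈ W
        · exact hDW b hb
        · exact ih.tail (Finset.mem_filter.2 ⟨hab, fun h => absurd h hb⟩)
    refine exists_isFeasibleTree_of_subset (D := D) (Finset.filter_subset _ _)
      (fun t ht => hD t (hspan t ht)) fun a ha hall => ?_
    have hback : ∀ a ∈ D, a.2 ∈ W → a.1 ∈ W := fun a ha h => ((Finset.mem_filter.1 ha).2 h).2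
    exact ((Finset.mem_filter.1 ha).2 (mem_of_reaches (hall w hwT) hw hback)).1
  · push Not at hWT
    set E₀ := E.filter fun a => a.1 ∉ W ∧ a.2 ∉ W with hE₀
    set A : Set V := {v | v ∉ W ∧ ∃ w ∈ W, (w, v) ∈ E} with hA
    have hjoin : ∀ v, Joins E₀ {v}ᶜ A T := by
      intro v
      -- a path to a terminal that does not meet `v` outside `W`
      obtain ⟨t, ht, hrt⟩ : ∃ t ∈ T, ReflTransGen
          (fun x y => (x, y) ∈ E ∧ (y ∉ W → y ≠ v)) r t := by
        by_cases hv : v ∈ W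
        · obtain ⟨t, ht⟩ := hT
          refine ⟨t, ht, ReflTransGen.mono (fun x y hxy => ⟨hxy, ?_⟩) _ _ (hspan t ht)⟩
          rintro hy rfl
          exact hy hv
        · obtain ⟨t, ht, hrt⟩ := hsep v hv
          refine ⟨t, ht, ReflTransGen.mono (fun x y hxy => ?_) _ _ hrt⟩
          have := Finset.mem_filter.1 hxy
          exact ⟨this.1, fun _ => this.2⟩
      have key : t ∈ W ∨ ∃ a ∈ A, a ≠ v ∧ ReflTransGen (StepIn E₀ {v}ᶜ) a t := by
        clear ht
        induction hrt with
        | refl => exact .inl hrW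
        | @tail a b _ hab ih =>
          by_cases hb : b ∈ W
          · exact .inl hb
          have hbv := hab.2 hb
          by_cases ha : a ∈ W
          · exact .inr ⟨b, ⟨hb, a, ha, hab.1⟩, hbv, .refl⟩
          obtain ⟨c, hc, hcv, hca⟩ := ih.resolve_left ha
          exact .inr ⟨c, hc, hcv, hca.tail ⟨Finset.mem_filter.2 ⟨hab.1, ha, hb⟩, hbv⟩⟩
      obtain ⟨a, ha, hav, hat⟩ := key.resolve_left (hWT t ht)
      exact ⟨a, ha, t, ht, hav, hat⟩
    have : Nonempty V := ⟨r⟩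
    obtain ⟨X, ⟨a₁, ha₁, t₁, ht₁, hX₁, hp₁⟩, ⟨a₂, ha₂, t₂, ht₂, hX₂, hp₂⟩⟩ :=
      exists_disjoint_joins E₀ A T hjoin
    set X₁ : Set V := {v | ReflTransGen (StepIn E₀ X) a₁ v} with hX₁def
    set X₂ : Set V := {v | ReflTransGen (StepIn E₀ Xᶜ) a₂ v} with hX₂def
    have hX₁X : ∀ v ∈ X₁, v ∈ X := fun v hv => StepIn.mem_of_reflTransGen hv hX₁
    have hX₂X : ∀ v ∈ X₂, v ∉ X := fun v hv => StepIn.mem_of_reflTransGen (X := Xᶜ) hv hX₂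
    have hX₁W : ∀ v ∈ X₁, v ∉ W := by
      intro v hv
      cases hv with
      | refl => exact ha₁.1
      | tail _ h => exact (Finset.mem_filter.1 h.1).2.2
    have hX₂W : ∀ v ∈ X₂, v ∉ W := by
      intro v hv
      cases hv with
      | refl => exact ha₂.1
      | tail _ h => exact (Finset.mem_filter.1 h.1).2.2
    set D := E.filter fun a => (a.2 ∈ W → a ∈ G ∧ a.1 ∈ W) ∧ (a.2 ∈ X₁ → a.1 ∈ X₁ ∪ W) ∧
      (a.2 ∈ X₂ → a.1 ∈ X₂ ∪ W) with hDdef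
    have hDW : ∀ v ∈ W, Reaches D r v := by
      intro v hv
      have : Reaches (E ∩ G) r v := hv
      induction this with
      | refl => exact .refl
      | @tail a b hra hab ih =>
        have hab' := Finset.mem_inter.1 hab
        exact (ih hra).tail (Finset.mem_filter.2 ⟨hab'.1, fun _ => ⟨hab'.2, hra⟩,
          fun h => absurd hv (hX₁W _ h), fun h => absurd hv (hX₂W _ h)⟩)
    have hDX₁ : ∀ v ∈ X₁, Reaches D r v := by
      intro v hv
      have hv' : ReflTransGen (StepIn E₀ X) a₁ v := hv
      induction hv' with
      | refl =>
        obtain ⟨hn, w, hw, hwa⟩ := ha₁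
        exact (hDW w hw).tail (Finset.mem_filter.2 ⟨hwa, fun h => absurd h hn, fun _ => .inr hw,
          fun h => absurd hX₁ (hX₂X _ h)⟩)
      | @tail a b hra hab ih =>
        have hb := (Finset.mem_filter.1 hab.1).2.2
        exact (ih hra).tail (Finset.mem_filter.2 ⟨(Finset.mem_filter.1 hab.1).1,
          fun h => absurd h hb, fun _ => .inl hra, fun h => absurd hab.2 (hX₂X _ h)⟩)
    have hDX₂ : ∀ v ∈ X₂, Reaches D r v := by
      intro v hv
      have hv' : ReflTransGen (StepIn E₀ Xᶜ) a₂ v := hv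
      induction hv' with
      | refl =>
        obtain ⟨hn, w, hw, hwa⟩ := ha₂
        exact (hDW w hw).tail (Finset.mem_filter.2 ⟨hwa, fun h => absurd h hn,
          fun h => absurd (hX₁X _ h) hX₂, fun _ => .inr hw⟩)
      | @tail a b hra hab ih =>
        have hb := (Finset.mem_filter.1 hab.1).2.2
        exact (ih hra).tail (Finset.mem_filter.2 ⟨(Finset.mem_filter.1 hab.1).1,
          fun h => absurd h hb, fun h => absurd (hX₁X _ h) hab.2, fun _ => .inl hra⟩)
    have hD : ∀ v, Reaches E r v → Reaches D r v := by
      intro v hv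
      induction hv with
      | refl => exact .refl
      | @tail a b _ hab ih =>
        by_cases hb : b ∈ W
        · exact hDW b hb
        by_cases hb₁ : b ∈ X₁
        · exact hDX₁ b hb₁
        by_cases hb₂ : b ∈ X₂
        · exact hDX₂ b hb₂
        exact ih.tail (Finset.mem_filter.2 ⟨hab, fun h => absurd h hb, fun h => absurd h hb₁,
          fun h => absurd h hb₂⟩)
    refine exists_isFeasibleTree_of_subset (D := D) (Finset.filter_subset _ _)
      (fun t ht => hD t (hspan t ht)) fun a ha hall => ?_
    by_cases haW : a.2 ∈ W
    · exact ((Finset.mem_filter.1 ha).2.1 haW).1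
    have hWback : ∀ a ∈ D, a.2 ∈ W → a.1 ∈ W := fun a ha h => ((Finset.mem_filter.1 ha).2.1 h).2
    have h₁ : a.2 ∈ X₁ ∪ W := by
      refine mem_of_reaches (hall t₁ ht₁) (.inl hp₁) fun a ha h => ?_
      exact h.elim (Finset.mem_filter.1 ha).2.2.1 fun h => .inr (hWback a ha h)
    have h₂ : a.2 ∈ X₂ ∪ W := by
      refine mem_of_reaches (hall t₂ ht₂) (.inl hp₂) fun a ha h => ?_
      exact h.elim (Finset.mem_filter.1 ha).2.2.2 fun h => .inr (hWback a ha h)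
    exact absurd (hX₁X _ (h₁.resolve_right haW)) (hX₂X _ (h₂.resolve_right haW))

end Feasible

/-! ### The auxiliary digraph -/

section Auxiliary

variable {V : Type}

open Relation

/-- `π` maps every vertex of the path of `S` from `r` to `t`, except for `r`, to its predecessor on
the path, and it fixes the other vertices. -/
def IsPathPredecessor (S : Finset (V × V)) (t : V) (π : V → V) : Prop :=
  ∀ x, ((π x, x) ∈ S ∧ Reaches S x t) ∨ (π x = x ∧ ∀ u, (u, x) ∈ S → ¬ Reaches S x t)

/-- The arcs of the auxiliary digraph on two copies of the vertex set, marked by `0` and `1`. In the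
first copy one walks along arcs of `H₀`, then one moves to the second copy, where one walks along
arcs of `H₁` or backwards on the path given by `π`. An arc that enters the path is followed by a
backward step, as in the residual graph of a unit flow along the path, when vertices have capacity
one. -/
inductive AuxStep (H₀ H₁ : Finset (V × V)) (π : V → V) : V × ℕ → V × ℕ → Prop
  | first {u v : V} : (u, v) ∈ H₀ → AuxStep H₀ H₁ π (u, 0) (v, 0)
  | second {u v : V} : (u, v) ∈ H₁ → AuxStep H₀ H₁ π (u, 1) (π v, 1)
  | switch (v : V) : AuxStep H₀ H₁ π (v, 0) (v, 1)
  | back (v : V) : AuxStep H₀ H₁ π (v, 1) (π v, 1)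

variable {r : V} {T : Finset V} {G : Finset (V × V)} {S : Finset (V × V)} {π : V → V} {t₁ : V}

/-- If the second copy of a terminal can be reached in the auxiliary digraph, then there is no
bottleneck. Indeed, suppose that `v` separates `r` from `T`. Then `v` lies on the path of `S`, and
by induction only vertices that can be reached without `v` are visited in the second copy. -/
theorem noBottleneck_of_auxReaches [DecidableEq V] {E : Finset (V × V)} (hS : IsTreeRootedAt r S)
    (hSE : S ⊆ E) (hST : ∀ t ∈ T, Reaches S r t) (ht₁ : t₁ ∈ T) (hπ : IsPathPredecessor S t₁ π)
    {t : V} (ht : t ∈ T) (h : ReflTransGen (AuxStep (E ∩ G) E π) (r, 0) (t, 1)) :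
    NoBottleneck r T G E := by
  refine ⟨fun t ht => (hST t ht).mono hSE, fun v hv => ?_⟩
  by_contra! hsep
  have hrv : v ≠ r := by rintro rfl; exact hv .refl
  have hSv : arcsAvoiding S v ⊆ arcsAvoiding E v := Finset.filter_subset_filter _ hSE
  -- the path of `S` from `r` to `t₁` passes through `v`
  obtain ⟨hrv', hvt₁⟩ := ((hST t₁ ht₁).avoiding_or v).resolve_left
    fun h => hsep t₁ ht₁ (h.mono hSv)
  have hA : ∀ x, Reaches (arcsAvoiding E v) r x → Reaches S x t₁ →
      TransGen (fun x y => (x, y) ∈ S) x v := fun x hx hxt =>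
    ((hxt.avoiding_or v).resolve_left
      fun h => hsep t₁ ht₁ (ReflTransGen.trans hx (h.mono hSv))).1
  have hB : ∀ u, TransGen (fun x y => (x, y) ∈ S) u v → Reaches (arcsAvoiding E v) r u := by
    intro u hu
    obtain ⟨w, huw, -⟩ := TransGen.head'_iff.1 hu
    rcases (hS.reachable _ huw).avoiding_or v with h | ⟨-, h⟩
    · exact h.mono hSv
    · exact absurd (TransGen.trans_right h hu)
        (hS.not_transGen_self hrv'.to_reflTransGen)
  have hpred : ∀ x, Reaches (arcsAvoiding E v) r x → Reaches (arcsAvoiding E v) r (π x) := by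
    intro x hx
    rcases hπ x with ⟨h1, h2⟩ | ⟨h1, -⟩
    · exact hB _ (.head h1 (hA x hx h2))
    · rwa [h1]
  have hinv : ∀ p, ReflTransGen (AuxStep (E ∩ G) E π) (r, 0) p →
      (p.2 = 0 → Reaches (E ∩ G) r p.1) ∧ (p.2 = 1 → Reaches (arcsAvoiding E v) r p.1) := by
    intro p hp
    induction hp with
    | refl => exact ⟨fun _ => .refl, fun h => absurd h (by simp)⟩
    | tail _ hstep ih =>
      cases hstep with
      | first hab => exact ⟨fun _ => (ih.1 rfl).tail hab, fun h => absurd h (by simp)⟩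
      | @second y x hyx =>
        refine ⟨fun h => absurd h (by simp), fun _ => ?_⟩
        have hy : Reaches (arcsAvoiding E v) r y := ih.2 rfl
        change Reaches (arcsAvoiding E v) r (π x)
        by_cases hxv : x = v
        · subst hxv
          rcases hπ x with ⟨h1, h2⟩ | ⟨-, h2⟩
          · exact hB _ (.single h1)
          · obtain ⟨u, -, hu⟩ := TransGen.tail'_iff.1 hrv'
            exact absurd hvt₁ (h2 u hu)
        · exact hpred x (hy.tail (Finset.mem_filter.2 ⟨hyx, hxv⟩))
      | switch x =>
        refine ⟨fun h => absurd h (by simp), fun _ => ?_⟩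
        have hx : Reaches (E ∩ G) r x := ih.1 rfl
        rcases hx.avoiding_or v with h | ⟨h, -⟩
        · exact h.mono (Finset.filter_subset_filter _ Finset.inter_subset_left)
        · exact absurd h.to_reflTransGen hv
      | back x => exact ⟨fun h => absurd h (by simp), fun _ => hpred x (ih.2 rfl)⟩
  exact hsep t ht ((hinv _ h).2 rfl)

/-- A feasible tree yields a walk in the auxiliary digraph that uses its arcs only, those that carry
all terminals in the first copy and the others in the second copy. Otherwise the tree could leave
the set of the vertices reached in the second copy only through the first vertex `z` of the path
of `S` outside this set. Then the arc to `z` would carry all terminals, and `z` would be reached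
after all. -/
theorem IsFeasibleTree.exists_auxReaches {F F₀ F₁ : Finset (V × V)} (hF : IsFeasibleTree r T G F)
    (hF₀ : ∀ a, a ∈ F₀ ↔ a ∈ F ∧ ∀ t ∈ T, Reaches F a.2 t) (hF₁ : ∀ a ∈ F, a ∉ F₀ → a ∈ F₁)
    (hS : IsTreeRootedAt r S) (ht₁ : t₁ ∈ T) (hSt : Reaches S r t₁)
    (hπ : IsPathPredecessor S t₁ π) :
    ∃ t ∈ T, ReflTransGen (AuxStep F₀ F₁ π) (r, 0) (t, 1) := by
  by_contra! hno
  set U : Set V := {x | ReflTransGen (AuxStep F₀ F₁ π) (r, 0) (x, 1)} with hU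
  have hfirst : ∀ x, ReflTransGen (AuxStep F₀ F₁ π) (r, 0) (x, 0) → x ∈ U :=
    fun x hx => hx.tail (.switch x)
  have hrU : r ∈ U := hfirst r .refl
  have hstem : ∀ a ∈ F₀, a.2 ∈ U := by
    rintro ⟨y, x⟩ hyx
    obtain ⟨hyxF, hx⟩ := (hF₀ _).1 hyx
    have hrx : Reaches F r x := (hF.tree.reachable _ hyxF).tail hyxF
    refine hfirst x (ReflTransGen.lift (fun z => (z, 0)) (fun p q hpq => ?_) _ _
      (hF.reaches_of_carries hrx hx))
    exact .first ((hF₀ _).2 ⟨hpq.1, hpq.2.2⟩)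
  have hparent : ∀ u x, (u, x) ∈ S → Reaches S x t₁ → x ∈ U → u ∈ U := by
    intro u x hux hxt hx
    rcases hπ x with ⟨h1, -⟩ | ⟨-, h2⟩
    · obtain rfl : π x = u := congrArg Prod.fst (hS.entering_unique _ h1 _ hux rfl)
      exact ReflTransGen.tail hx (.back x)
    · exact absurd hxt (h2 u hux)
  have hanc : ∀ x p, Reaches S x p → Reaches S p t₁ → p ∈ U → x ∈ U := by
    intro x p hxp hpt hp
    induction hxp using ReflTransGen.head_induction_on with
    | refl => exact hp
    | head hac hcp ih => exact hparent _ _ hac (ReflTransGen.trans hcp hpt) ih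
  obtain ⟨p, z, hp, hz, hpz, hzt⟩ := ReflTransGen.exists_exit hSt hrU (hno t₁ ht₁)
  have hexit : ∀ y x, (y, x) ∈ F → y ∈ U → x ∉ U → x = z := by
    intro y x hyx hy hx
    by_cases hyx₀ : (y, x) ∈ F₀
    · exact absurd (hstem _ hyx₀) hx
    have hπx : π x ∈ U := ReflTransGen.tail hy (.second (hF₁ _ hyx hyx₀))
    rcases hπ x with ⟨h1, h2⟩ | ⟨h1, -⟩
    · have hprev : ∀ q w w', (q, w) ∈ S → Reaches S w t₁ → q ∈ U → w' ∉ U →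
          Reaches S w' w → w' = w := by
        intro q w w' hqw hwt hq hw' hww
        rcases ReflTransGen.cases_tail hww with rfl | ⟨q', hq', hq'w⟩
        · rfl
        · obtain rfl : q' = q := congrArg Prod.fst (hS.entering_unique _ hq'w _ hqw rfl)
          exact absurd (hanc w' q' hq' (.head hqw hwt) hq) hw'
      have htotal : Reaches S x z ∨ Reaches S z x := by
        have huniq : Relator.RightUnique (Function.swap fun x y => (x, y) ∈ S) :=
          fun a b c hb hc => congrArg Prod.fst (hS.entering_unique _ hb _ hc rfl)
        have := ReflTransGen.total_of_right_unique huniq (reflTransGen_swap.2 h2)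
          (reflTransGen_swap.2 hzt)
        exact this.symm.imp reflTransGen_swap.1 reflTransGen_swap.1
      rcases htotal with h | h
      · exact hprev p z x hpz hzt hp hx h
      · exact (hprev _ x z h1 h2 hπx hz h).symm
    · exact absurd (h1 ▸ hπx) hx
  have hall : ∀ t ∈ T, (∃ y ∈ U, (y, z) ∈ F) ∧ Reaches F z t := by
    intro t ht
    obtain ⟨y, x, hy, hx, hyx, hxt⟩ := ReflTransGen.exists_exit (hF.spans t ht) hrU (hno t ht)
    obtain rfl := hexit y x hyx hy hx
    exact ⟨⟨y, hy, hyx⟩, hxt⟩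
  obtain ⟨⟨y, -, hyz⟩, -⟩ := hall t₁ ht₁
  exact hz (hstem (y, z) ((hF₀ _).2 ⟨hyz, fun t ht => (hall t ht).2⟩))

end Auxiliary

/-! ### Cheapest walks -/

section CheapestWalks

variable {N M : Type}

open Relation

/-- A list with at most one element, namely a cheapest one of `l` (an element is a node with a cost
and a list). -/
def cheapest (l : List (N × ℕ × List M)) : List (N × ℕ × List M) :=
  l.foldl (fun acc c => if acc.all (fun b => decide (c.2.1 < b.2.1)) = true then [c] else acc) []

theorem cheapest_append (l : List (N × ℕ × List M)) (c : N × ℕ × List M) :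
    cheapest (l ++ [c]) =
      if (cheapest l).all (fun b => decide (c.2.1 < b.2.1)) = true then [c] else cheapest l := by
  rw [cheapest, List.foldl_append]
  rfl

theorem cheapest_spec (l : List (N × ℕ × List M)) :
    (cheapest l = [] ∧ l = []) ∨
      ∃ c ∈ l, cheapest l = [c] ∧ ∀ d ∈ l, c.2.1 ≤ d.2.1 := by
  induction l using List.reverseRecOn with
  | nil => exact .inl ⟨rfl, rfl⟩
  | append_singleton l c ih =>
    right
    rw [cheapest_append]
    rcases ih with ⟨h, rfl⟩ | ⟨b, hb, h, hle⟩
    · exact ⟨c, by simp, by simp [h], by simp⟩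
    · by_cases hcb : c.2.1 < b.2.1
      · refine ⟨c, by simp, by simp [h, hcb], fun d hd => ?_⟩
        rcases List.mem_append.1 hd with hd | hd
        · exact hcb.le.trans (hle d hd)
        · rw [List.mem_singleton.1 hd]
      · refine ⟨b, by simp [hb], by simp [h, hcb], fun d hd => ?_⟩
        rcases List.mem_append.1 hd with hd | hd
        · exact hle d hd
        · rw [List.mem_singleton.1 hd]; omega

theorem length_cheapest_le (l : List (N × ℕ × List M)) : (cheapest l).length ≤ 1 := by
  rcases cheapest_spec l with ⟨h, -⟩ | ⟨c, -, h, -⟩ <;> simp [h]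

theorem mem_of_mem_cheapest {l : List (N × ℕ × List M)} {c : N × ℕ × List M}
    (h : c ∈ cheapest l) : c ∈ l := by
  rcases cheapest_spec l with ⟨h', -⟩ | ⟨d, hd, h', -⟩
  · simp [h'] at h
  · rw [h', List.mem_singleton] at h
    exact h ▸ hd

theorem exists_mem_cheapest {l : List (N × ℕ × List M)} {d : N × ℕ × List M} (hd : d ∈ l) :
    ∃ c ∈ cheapest l, c.2.1 ≤ d.2.1 := by
  rcases cheapest_spec l with ⟨-, rfl⟩ | ⟨c, -, h, hle⟩
  · simp at hd
  · exact ⟨c, by simp [h], hle d hd⟩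

/-- Appends the edge `e` (tail, head, cost, list) to a walk with label `c` (end, cost, list). -/
def extendLabel (c : N × ℕ × List M) (e : (N × N) × ℕ × List M) : N × ℕ × List M :=
  (e.1.2, c.2.1 + e.2.1, c.2.2 ++ e.2.2)

variable [DecidableEq N]

/-- One round of the Bellman-Ford algorithm: every edge extends a cheapest label at its tail. -/
def relax (s : N) (D : List ((N × N) × ℕ × List M)) (L : List (N × ℕ × List M)) :
    List (N × ℕ × List M) :=
  (s, 0, []) :: D.flatMap fun e =>
    (cheapest (L.filter fun c => decide (c.1 = e.1.1))).map fun c => extendLabel c e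

/-- Labels of cheapest walks starting in `s`, after as many rounds as there are edges. -/
def labels (s : N) (D : List ((N × N) × ℕ × List M)) : List (N × ℕ × List M) :=
  D.foldl (fun L _ => relax s D L) [(s, 0, [])]

omit [DecidableEq N] in
theorem foldl_const_eq_iterate {α β : Type} (f : α → α) (l : List β) (a : α) :
    l.foldl (fun x _ => f x) a = f^[l.length] a := by
  induction l generalizing a with
  | nil => rfl
  | cons b l ih => simp [ih]

theorem labels_eq (s : N) (D : List ((N × N) × ℕ × List M)) :
    labels s D = (relax s D)^[D.length] [(s, 0, [])] :=
  foldl_const_eq_iterate _ _ _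

/-- `IsWalk s l v`: the edges of `l` form a walk from `s` to `v`. -/
inductive IsWalk (s : N) : List ((N × N) × ℕ × List M) → N → Prop
  | nil : IsWalk s [] s
  | snoc {l : List ((N × N) × ℕ × List M)} {e : (N × N) × ℕ × List M} :
      IsWalk s l e.1.1 → IsWalk s (l ++ [e]) e.1.2

/-- Total cost of a list of edges. -/
def walkCost (l : List ((N × N) × ℕ × List M)) : ℕ := (l.map fun e => e.2.1).sum

variable {s : N} {D : List ((N × N) × ℕ × List M)}

theorem exists_isWalk_of_mem_relax (k : ℕ) :
    ∀ c ∈ (relax s D)^[k] [(s, 0, [])], ∃ l ⊆ D, IsWalk s l c.1 ∧ c.2.1 = walkCost l ∧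
      c.2.2 = l.flatMap fun e => e.2.2 := by
  induction k with
  | zero =>
    intro c hc
    obtain rfl : c = (s, 0, []) := by simpa using hc
    exact ⟨[], by simp, .nil, rfl, rfl⟩
  | succ k ih =>
    intro c hc
    rw [Function.iterate_succ_apply', relax, List.mem_cons, List.mem_flatMap] at hc
    rcases hc with rfl | ⟨e, he, hc⟩
    · exact ⟨[], by simp, .nil, rfl, rfl⟩
    · obtain ⟨d, hd, rfl⟩ := List.mem_map.1 hc
      have hd' := List.mem_filter.1 (mem_of_mem_cheapest hd)
      obtain ⟨l, hl, hw, hcost, hpay⟩ := ih d hd'.1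
      have hde : d.1 = e.1.1 := of_decide_eq_true hd'.2
      refine ⟨l ++ [e], by simp [hl, he], .snoc (hde ▸ hw), ?_, ?_⟩
      · simp [extendLabel, walkCost, hcost]
      · simp [extendLabel, hpay]

theorem exists_mem_relax {l : List ((N × N) × ℕ × List M)} {v : N} (hw : IsWalk s l v) (hl : l ⊆ D)
    {k : ℕ} (hk : l.length ≤ k) :
    ∃ c ∈ (relax s D)^[k] [(s, 0, [])], c.1 = v ∧ c.2.1 ≤ walkCost l := by
  induction hw generalizing k with
  | nil =>
    refine ⟨(s, 0, []), ?_, rfl, Nat.zero_le _⟩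
    cases k with
    | zero => simp
    | succ k => rw [Function.iterate_succ_apply', relax]; simp
  | @snoc l e _ ih =>
    rw [List.length_append, List.length_singleton] at hk
    obtain ⟨k, rfl⟩ := Nat.exists_eq_add_of_lt hk
    obtain ⟨c, hc, hce, hcost⟩ := ih (fun x hx => hl (by simp [hx])) (k := l.length + k) (by omega)
    obtain ⟨d, hd, hdc⟩ := exists_mem_cheapest (l := ((relax s D)^[l.length + k]
      [(s, 0, [])]).filter fun c => decide (c.1 = e.1.1)) (List.mem_filter.2 ⟨hc, by simp [hce]⟩)
    refine ⟨extendLabel d e, ?_, rfl, ?_⟩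
    · rw [Function.iterate_succ_apply', relax]
      exact List.mem_cons_of_mem _ (List.mem_flatMap.2
        ⟨e, hl (by simp), List.mem_map.2 ⟨d, hd, rfl⟩⟩)
    · simp only [extendLabel, walkCost, List.map_append, List.sum_append, List.map_cons,
        List.map_nil, List.sum_singleton] at hcost ⊢
      omega

omit [DecidableEq N] in
theorem IsWalk.exists_prefix {l : List ((N × N) × ℕ × List M)} {v : N} (hw : IsWalk s l v)
    {e : (N × N) × ℕ × List M} (he : e ∈ l) : ∃ l', l' <+: l ∧ IsWalk s l' e.1.2 := by
  induction hw with
  | nil => simp at he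
  | @snoc l e' hw ih =>
    rcases List.mem_append.1 he with he | he
    · obtain ⟨l', h1, h2⟩ := ih he
      exact ⟨l', h1.trans (List.prefix_append _ _), h2⟩
    · obtain rfl := List.mem_singleton.1 he
      exact ⟨_, List.prefix_rfl, .snoc hw⟩

omit [DecidableEq N] in
/-- A reachable vertex is reached by a walk without repeated edges. -/
theorem exists_nodup_isWalk {P : (N × N) × ℕ × List M → Prop} {v : N}
    (h : ReflTransGen (fun x y => ∃ w, P ((x, y), w)) s v) :
    ∃ l, (∀ e ∈ l, P e) ∧ l.Nodup ∧ IsWalk s l v := by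
  induction h with
  | refl => exact ⟨[], by simp, List.nodup_nil, .nil⟩
  | @tail x y _ hxy ih =>
    obtain ⟨w, hw⟩ := hxy
    obtain ⟨l, hlP, hl, hwalk⟩ := ih
    by_cases he : ((x, y), w) ∈ l
    · obtain ⟨l', hpre, hwalk'⟩ := hwalk.exists_prefix he
      exact ⟨l', fun e he => hlP e (hpre.subset he), hl.sublist hpre.sublist, hwalk'⟩
    · refine ⟨l ++ [((x, y), w)], ?_, ?_, .snoc hwalk⟩
      · intro e he
        rcases List.mem_append.1 he with he | he
        · exact hlP e he
        · rw [List.mem_singleton.1 he]; exact hw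
      · rw [List.nodup_append]
        refine ⟨hl, List.nodup_singleton _, ?_⟩
        rintro a ha b hb rfl
        exact he (List.mem_singleton.1 hb ▸ ha)

theorem exists_isWalk_of_mem_labels {c : N × ℕ × List M} (hc : c ∈ labels s D) :
    ∃ l ⊆ D, IsWalk s l c.1 ∧ c.2.1 = walkCost l ∧ c.2.2 = l.flatMap fun e => e.2.2 :=
  exists_isWalk_of_mem_relax _ c (labels_eq s D ▸ hc)

theorem exists_mem_labels {l : List ((N × N) × ℕ × List M)} {v : N} (hw : IsWalk s l v)
    (hl : l ⊆ D) (hnd : l.Nodup) : ∃ c ∈ labels s D, c.1 = v ∧ c.2.1 ≤ walkCost l := by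
  rw [labels_eq]
  exact exists_mem_relax hw hl (hnd.subperm hl).length_le

/-- The vertices that can be reached from `r` along the arcs of `A`. -/
def reachList (A : List (N × N)) (r : N) : List N :=
  (labels r (A.map fun a => (a, 0, ([] : List ℕ)))).map fun c => c.1

theorem mem_reachList {A : List (N × N)} {r v : N} :
    v ∈ reachList A r ↔ Reaches A.toFinset r v := by
  rw [reachList, List.mem_map]
  constructor
  · rintro ⟨c, hc, rfl⟩
    obtain ⟨l, hl, hw, -⟩ := exists_isWalk_of_mem_labels hc
    generalize c.1 = v at hw
    clear hc
    induction hw with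
    | nil => exact .refl
    | @snoc l e _ ih =>
      have he := hl (show e ∈ l ++ [e] by simp)
      obtain ⟨a, ha, rfl⟩ := List.mem_map.1 he
      exact (ih fun x hx => hl (by simp [hx])).tail (List.mem_toFinset.2 ha)
  · intro h
    obtain ⟨l, hl, hnd, hw⟩ := exists_nodup_isWalk (s := r) (v := v)
      (P := fun e => e ∈ A.map fun a => (a, 0, ([] : List ℕ)))
      (ReflTransGen.mono (fun x y hxy =>
        ⟨(0, []), List.mem_map.2 ⟨(x, y), List.mem_toFinset.1 hxy, rfl⟩⟩) _ _ h)
    obtain ⟨c, hc, hcv, -⟩ := exists_mem_labels hw hl hnd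
    exact ⟨c, hc, hcv⟩

end CheapestWalks

namespace PolyTime

variable {α N M : Type} [Enc α] [Enc N] [Enc M]

@[fun_prop]
theorem cheapest {l : α → List (N × ℕ × List M)} (hl : PolyTime l) :
    PolyTime (fun a => cheapest (l a)) := by
  refine hl.foldl (c := fun _ => []) (s := fun _ acc c =>
    if acc.all (fun b => decide (c.2.1 < b.2.1)) = true then [c] else acc) (by fun_prop)
    (by fun_prop) ?_
  obtain ⟨p, hp⟩ := hl.exists_size_le
  refine ⟨p + 2, fun a m hm => ?_⟩
  change (enc (_root_.cheapest m)).size ≤ _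
  rw [Polynomial.eval_add, Polynomial.eval_ofNat]
  rcases cheapest_spec m with ⟨h, -⟩ | ⟨c, hc, h, -⟩
  · rw [h, size_enc_nil]; omega
  · have := (size_enc_lt_of_mem (hm.subset hc)).trans_le (hp a)
    rw [h, size_enc_cons, size_enc_nil]
    omega

@[fun_prop]
theorem extendLabel {c : α → N × ℕ × List M} {e : α → (N × N) × ℕ × List M} (hc : PolyTime c)
    (he : PolyTime e) : PolyTime (fun a => extendLabel (c a) (e a)) := by
  unfold _root_.extendLabel
  fun_prop

theorem size_enc_extendLabel_le (c : N × ℕ × List M) (e : (N × N) × ℕ × List M) :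
    (enc (_root_.extendLabel c e)).size ≤ (enc c).size + (enc e).size := by
  have h1 := Nat.size_add_le c.2.1 e.2.1
  have h2 := size_enc_append c.2.2 e.2.2
  simp only [_root_.extendLabel, size_enc_prod, enc_nat, Value.size]
  omega

variable [DecidableEq N]

@[fun_prop]
theorem relax [InjectiveEnc N] {s : α → N} {D : α → List ((N × N) × ℕ × List M)}
    {L : α → List (N × ℕ × List M)} (hs : PolyTime s) (hD : PolyTime D) (hL : PolyTime L) :
    PolyTime (fun a => relax (s a) (D a) (L a)) := by
  unfold _root_.relax
  fun_prop

/-- A label grows by at most the size of an edge in each round, and there are at most as many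
labels as edges, apart from the initial one. -/
theorem size_enc_relax_le (s : N) (D : List ((N × N) × ℕ × List M)) (k : ℕ) :
    (∀ c ∈ (_root_.relax s D)^[k] [(s, 0, [])],
      (enc c).size ≤ (enc s).size + 5 + k * (enc D).size) ∧
    ((_root_.relax s D)^[k] [(s, 0, [])]).length ≤ D.length + 1 := by
  have h0 : (enc ((s, 0, []) : N × ℕ × List M)).size ≤ (enc s).size + 5 := by
    simp [size_enc_prod, size_enc_nil, enc_nat, Value.size]
  induction k with
  | zero => simpa using h0
  | succ k ih =>
    rw [Function.iterate_succ_apply', _root_.relax]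
    constructor
    · intro c hc
      rw [add_mul, one_mul]
      rcases List.mem_cons.1 hc with rfl | hc
      · omega
      · obtain ⟨e, he, hc⟩ := List.mem_flatMap.1 hc
        obtain ⟨d, hd, rfl⟩ := List.mem_map.1 hc
        have h1 := ih.1 d (List.mem_filter.1 (mem_of_mem_cheapest hd)).1
        have h2 := size_enc_extendLabel_le d e
        have h3 := size_enc_lt_of_mem he
        omega
    · rw [List.length_cons, List.length_flatMap]
      refine Nat.succ_le_succ ((List.sum_le_card_nsmul _ 1 ?_).trans (by simp))
      intro n hn
      obtain ⟨e, -, rfl⟩ := List.mem_map.1 hn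
      rw [List.length_map]
      exact length_cheapest_le _

@[fun_prop]
theorem labels [InjectiveEnc N] {s : α → N} {D : α → List ((N × N) × ℕ × List M)}
    (hs : PolyTime s) (hD : PolyTime D) : PolyTime (fun a => labels (s a) (D a)) := by
  refine hD.foldl (c := fun a => [(s a, 0, [])]) (s := fun a L _ => _root_.relax (s a) (D a) L)
    (by fun_prop) (by fun_prop) ?_
  obtain ⟨p, hp⟩ := hs.exists_size_le
  obtain ⟨q, hq⟩ := hD.exists_size_le
  refine ⟨(q + 1) * (p + 5 + q * q + 1) + 1, fun a m hm => ?_⟩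
  rw [foldl_const_eq_iterate]
  obtain ⟨h1, h2⟩ := size_enc_relax_le (s a) (D a) m.length
  have hlen := (length_lt_size_enc (D a)).le.trans (hq a)
  refine (size_enc_le_of_forall_mem h1).trans ?_
  simp only [Polynomial.eval_add, Polynomial.eval_mul, Polynomial.eval_one, Polynomial.eval_ofNat]
  gcongr
  · exact h2.trans (by omega)
  · exact hp a
  · exact hm.length_le.trans hlen
  · exact hq a

@[fun_prop]
theorem reachList [InjectiveEnc N] {A : α → List (N × N)} {r : α → N} (hA : PolyTime A)
    (hr : PolyTime r) : PolyTime (fun a => reachList (A a) (r a)) := by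
  unfold _root_.reachList
  fun_prop

end PolyTime

/-! ### The algorithm -/

section Algorithm

open Relation

variable {N : Type} [DecidableEq N]

/-- Tests for `NoBottleneck`; only heads of arcs have to be tested as bottlenecks. -/
def noBottleneckTest (r : N) (T : List N) (G E : List (N × N)) : Bool :=
  T.all (fun t => decide (t ∈ reachList E r)) &&
    E.all fun a => decide (a.2 ∈ reachList (E.filter fun e => decide (e ∈ G)) r) ||
      T.any fun t => decide (t ∈ reachList (E.filter fun e => !decide (e.2 = a.2)) r)

/-- Deletes arcs one by one as long as there is no bottleneck. -/
def prune (r : N) (T : List N) (G E : List (N × N)) : List (N × N) :=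
  E.foldl (fun F a => if noBottleneckTest r T G (F.filter fun e => !decide (e = a)) = true then
    F.filter fun e => !decide (e = a) else F) E

/-- The arcs of the path of the tree `S` that leads to `t`. -/
def pathArcs (S : List (N × N)) (t : N) : List (N × N) :=
  S.filter fun a => decide (t ∈ reachList S a.2)

/-- The tail of an arc of `P` that enters `x`; if there is no such arc, it is `x`. -/
def predecessor (P : List (N × N)) (x : N) : N :=
  P.foldl (fun u a => if decide (a.2 = x) = true then a.1 else u) x

/-- The auxiliary digraph, for a graph with weighted arcs `A`. The list at an edge consists of the
arcs of the graph that the edge uses. -/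
def auxEdges (r : N) (G : List (N × N)) (A : List ((N × N) × ℕ)) (P : List (N × N)) :
    List (((N × ℕ) × (N × ℕ)) × ℕ × List (N × N)) :=
  (r :: A.flatMap fun e => [e.1.1, e.1.2]).flatMap (fun v =>
    [(((v, 0), (v, 1)), 0, []), (((v, 1), (predecessor P v, 1)), 0, [])]) ++
  (A.map fun e => (((e.1.1, 1), (predecessor P e.1.2, 1)), e.2, [e.1])) ++
  ((A.filter fun e => decide (e.1 ∈ G)).map fun e => (((e.1.1, 0), (e.1.2, 0)), e.2, [e.1]))

/-- The last element of a list, or `r` if it is empty. -/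
def lastOr (r : N) (T : List N) : N := T.foldl (fun _ t => t) r

/-- The arcs of a cheapest walk in the auxiliary digraph to the second copy of a terminal. -/
def augmentingArcs (r : N) (T : List N) (G : List (N × N)) (A : List ((N × N) × ℕ))
    (S : List (N × N)) : List (N × N) :=
  (cheapest ((labels ((r, 0) : N × ℕ) (auxEdges r G A (pathArcs S (lastOr r T)))).filter fun c =>
    decide (c.1.2 = 1) && decide (c.1.1 ∈ T))).flatMap fun c => c.2.2

/-- A feasible tree made of arcs of the Steiner tree `S` and augmenting arcs. -/
def approxTree (r : N) (T : List N) (G : List (N × N)) (A : List ((N × N) × ℕ))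
    (S : List (N × N)) : List (N × N) :=
  prune r T G ((A.map fun e => e.1).filter fun a =>
    decide (a ∈ S) || decide (a ∈ augmentingArcs r T G A S))

variable {r : N} {T : List N} {G E S : List (N × N)}

omit [DecidableEq N] in
theorem lastOr_mem (r : N) (hT : T ≠ []) : lastOr r T ∈ T := by
  obtain ⟨l, a, rfl⟩ := List.eq_nil_or_concat T |>.resolve_left hT
  simp [lastOr]

theorem noBottleneckTest_iff (hT : T ≠ []) :
    noBottleneckTest r T G E = true ↔ NoBottleneck r T.toFinset G.toFinset E.toFinset := by
  have hG : (E.filter fun e => decide (e ∈ G)).toFinset = E.toFinset ∩ G.toFinset := by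
    ext; simp
  have hav : ∀ v, (E.filter fun e => !decide (e.2 = v)).toFinset = arcsAvoiding E.toFinset v := by
    intro v; ext; simp [arcsAvoiding]
  simp only [noBottleneckTest, Bool.and_eq_true, List.all_eq_true, Bool.or_eq_true,
    List.any_eq_true, decide_eq_true_eq, mem_reachList, hG, hav, NoBottleneck, List.mem_toFinset]
  refine and_congr_right fun hreach => ⟨fun h v hv => ?_, fun h a ha => ?_⟩
  · by_cases hhead : ∃ a ∈ E, a.2 = v
    · obtain ⟨a, ha, rfl⟩ := hhead
      exact (h a ha).resolve_left hv
    · obtain ⟨t, ht⟩ := List.exists_mem_of_ne_nil T hT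
      refine ⟨t, ht, ?_⟩
      refine (hreach t ht).mono fun a ha => ?_
      rw [arcsAvoiding, Finset.mem_filter]
      exact ⟨ha, fun h => hhead ⟨a, List.mem_toFinset.1 ha, h⟩⟩
  · by_cases hv : Reaches (E.toFinset ∩ G.toFinset) r a.2
    · exact .inl hv
    · exact .inr (h _ hv)

theorem noBottleneckTest_iff_exists (hT : T ≠ []) : noBottleneckTest r T G E = true ↔
    ∃ F ⊆ E.toFinset, IsFeasibleTree r T.toFinset G.toFinset F := by
  have hT' : T.toFinset.Nonempty := List.toFinset_nonempty_iff T |>.2 hT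
  rw [noBottleneckTest_iff hT]
  exact ⟨fun h => h.exists_isFeasibleTree hT', fun ⟨F, hFE, hF⟩ => hF.noBottleneck hFE hT'⟩

/-- What remains is a minimal arc set without bottleneck, hence a feasible tree. -/
theorem prune_spec (hT : T ≠ []) (hE : noBottleneckTest r T G E = true) :
    (prune r T G E).Sublist E ∧
      IsFeasibleTree r T.toFinset G.toFinset (prune r T G E).toFinset := by
  set step : List (N × N) → N × N → List (N × N) := fun F a =>
    if noBottleneckTest r T G (F.filter fun e => !decide (e = a)) = true then
      F.filter fun e => !decide (e = a) else F with hstep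
  have key : ∀ m : List (N × N), (m.foldl step E).Sublist E ∧
      noBottleneckTest r T G (m.foldl step E) = true ∧ ∀ a ∈ m, a ∈ m.foldl step E →
        ¬ ∃ F ⊆ ((m.foldl step E).filter fun e => !decide (e = a)).toFinset,
          IsFeasibleTree r T.toFinset G.toFinset F := by
    intro m
    induction m using List.reverseRecOn with
    | nil => exact ⟨List.Sublist.refl _, hE, by simp⟩
    | append_singleton m b ih =>
      obtain ⟨h1, h2, h3⟩ := ih
      rw [List.foldl_append, List.foldl_cons, List.foldl_nil]
      generalize m.foldl step E = L at h1 h2 h3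
      by_cases hb : noBottleneckTest r T G (L.filter fun e => !decide (e = b)) = true
      · have hs : step L b = L.filter fun e => !decide (e = b) := by simp only [hstep, hb, if_true]
        rw [hs]
        refine ⟨List.filter_sublist.trans h1, hb, fun a ha haL => ?_⟩
        have ham := (List.mem_append.1 ha).resolve_right fun h => by simp_all
        rintro ⟨F, hF, hfeas⟩
        refine h3 a ham (List.mem_filter.1 haL).1 ⟨F, hF.trans fun x hx => ?_, hfeas⟩
        simp only [List.mem_toFinset, List.mem_filter] at hx ⊢
        exact ⟨hx.1.1, hx.2⟩
      · have hs : step L b = L := by simp only [hstep, hb]; rfl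
        rw [hs]
        refine ⟨h1, h2, fun a ha haL => ?_⟩
        rcases List.mem_append.1 ha with ha | ha
        · exact h3 a ha haL
        · obtain rfl := List.mem_singleton.1 ha
          rwa [noBottleneckTest_iff_exists hT] at hb
  obtain ⟨h1, h2, h3⟩ := key E
  change (prune r T G E).Sublist E at h1
  change noBottleneckTest r T G (prune r T G E) = true at h2
  change ∀ a ∈ E, a ∈ prune r T G E → ¬ ∃ F ⊆ ((prune r T G E).filter _).toFinset, _ at h3
  refine ⟨h1, ?_⟩
  obtain ⟨F, hF, hfeas⟩ := (noBottleneckTest_iff_exists hT).1 h2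
  have hEq : F = (prune r T G E).toFinset := by
    refine hF.antisymm fun a ha => ?_
    by_contra haF
    have ha' := List.mem_toFinset.1 ha
    refine h3 a (h1.subset ha') ha' ⟨F, fun x hx => ?_, hfeas⟩
    have hxa : x ≠ a := fun h => haF (h ▸ hx)
    simpa [hxa] using hF hx
  exact hEq ▸ hfeas

theorem predecessor_spec (P : List (N × N)) (x : N) :
    (predecessor P x, x) ∈ P ∨ (predecessor P x = x ∧ ∀ u, (u, x) ∉ P) := by
  rw [predecessor]
  induction P using List.reverseRecOn with
  | nil => simp
  | append_singleton P b ih =>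
    obtain ⟨y, z⟩ := b
    rw [List.foldl_append, List.foldl_cons, List.foldl_nil]
    by_cases hz : z = x
    · subst hz; simp
    · simpa [hz, Ne.symm hz] using ih

theorem isPathPredecessor_predecessor (S : List (N × N)) (t : N) :
    IsPathPredecessor S.toFinset t (predecessor (pathArcs S t)) := by
  intro x
  have hmem : ∀ a, a ∈ pathArcs S t ↔ a ∈ S ∧ Reaches S.toFinset a.2 t := by
    intro a
    rw [pathArcs, List.mem_filter, decide_eq_true_eq, mem_reachList]
  have := predecessor_spec (pathArcs S t) x
  simpa only [hmem, not_and, List.mem_toFinset] using this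

/-- A walk in the auxiliary digraph uses the arcs in its list only. -/
theorem auxReaches_of_isWalk {A : List ((N × N) × ℕ)} {P : List (N × N)} {p : N × ℕ}
    {l : List (((N × ℕ) × (N × ℕ)) × ℕ × List (N × N))} (hw : IsWalk (r, 0) l p)
    (hl : l ⊆ auxEdges r G A P) {X : Finset (N × N)}
    (hX : ∀ e ∈ l, ∀ a ∈ e.2.2, a ∈ X) :
    ReflTransGen (AuxStep (X ∩ G.toFinset) X (predecessor P)) (r, 0) p := by
  induction hw with
  | nil => exact .refl
  | @snoc l e _ ih =>
    refine (ih (fun x hx => hl (by simp [hx])) fun x hx => hX x (by simp [hx])).tail ?_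
    have he := hl (show e ∈ l ++ [e] by simp)
    have heX := hX e (by simp)
    simp only [auxEdges, List.mem_append, List.mem_flatMap, List.mem_map, List.mem_filter,
      decide_eq_true_eq, List.mem_cons, List.not_mem_nil, or_false] at he
    rcases he with (⟨v, -, rfl | rfl⟩ | ⟨a, -, rfl⟩) | ⟨a, ⟨-, haG⟩, rfl⟩
    · exact .switch v
    · exact .back v
    · exact .second (heX a.1 (by simp))
    · exact .first (Finset.mem_inter.2 ⟨heX a.1 (by simp), List.mem_toFinset.2 haG⟩)

/-- Every edge of the auxiliary digraph costs as much as the arcs that it uses. -/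
theorem cost_of_mem_auxEdges {w : N × N → ℕ} {P : List (N × N)}
    {e : ((N × ℕ) × (N × ℕ)) × ℕ × List (N × N)}
    (he : e ∈ auxEdges r G (E.map fun a => (a, w a)) P) : e.2.1 = (e.2.2.map w).sum := by
  simp only [auxEdges, List.mem_append, List.mem_flatMap, List.mem_map, List.mem_filter,
    decide_eq_true_eq, List.mem_cons, List.not_mem_nil, or_false] at he
  rcases he with (⟨v, -, rfl | rfl⟩ | ⟨_, ⟨a, -, rfl⟩, rfl⟩) | ⟨_, ⟨⟨a, -, rfl⟩, -⟩, rfl⟩ <;> simp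

theorem walkCost_eq {w : N × N → ℕ} {P : List (N × N)}
    {l : List (((N × ℕ) × (N × ℕ)) × ℕ × List (N × N))}
    (hl : l ⊆ auxEdges r G (E.map fun a => (a, w a)) P) :
    walkCost l = ((l.flatMap fun e => e.2.2).map w).sum := by
  induction l with
  | nil => rfl
  | cons e l ih =>
    have h1 := cost_of_mem_auxEdges (hl (show e ∈ e :: l by simp))
    have h2 := ih fun x hx => hl (by simp [hx])
    simp only [walkCost, List.map_cons, List.sum_cons, List.flatMap_cons, List.map_append,
      List.sum_append] at h2 ⊢
    rw [h1, h2]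

/-- Some walk in the auxiliary digraph is at most as expensive as a given feasible tree `F`: no arc
of `F` is used twice, since arcs that carry all terminals are used in the first copy only, and the
other arcs in the second copy only. -/
theorem exists_cheap_isWalk (hT : T ≠ []) {w : N × N → ℕ} (hSE : S ⊆ E)
    (hS : IsTreeRootedAt r S.toFinset) (hST : ∀ t ∈ T, Reaches S.toFinset r t)
    {F : Finset (N × N)} (hFE : F ⊆ E.toFinset)
    (hF : IsFeasibleTree r T.toFinset G.toFinset F) :
    ∃ t ∈ T, ∃ l ⊆ auxEdges r G (E.map fun a => (a, w a)) (pathArcs S (lastOr r T)),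
      l.Nodup ∧ IsWalk ((r, 0) : N × ℕ) l (t, 1) ∧ walkCost l ≤ ∑ a ∈ F, w a := by
  classical
  set P := pathArcs S (lastOr r T) with hP
  set π := predecessor P with hπ
  set D := auxEdges r G (E.map fun a => (a, w a)) P with hD
  have hlast := lastOr_mem r hT
  have hpred := isPathPredecessor_predecessor S (lastOr r T)
  set F₀ := F.filter fun a => ∀ t ∈ T.toFinset, Reaches F a.2 t with hF₀
  obtain ⟨t, ht, hwalk⟩ := hF.exists_auxReaches (F₀ := F₀) (F₁ := F \ F₀)
    (fun a => Finset.mem_filter) (fun a ha ha' => Finset.mem_sdiff.2 ⟨ha, ha'⟩) hS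
    (List.mem_toFinset.2 hlast) (hST _ hlast) hpred
  -- the vertices to which the walk is restricted
  set VL : List N := r :: (E.map fun a => (a, w a)).flatMap fun e => [e.1.1, e.1.2] with hVL
  have hVLE : ∀ a ∈ E, a.1 ∈ VL ∧ a.2 ∈ VL := by
    intro a ha
    constructor <;>
    exact List.mem_cons_of_mem _ (List.mem_flatMap.2 ⟨(a, w a), List.mem_map.2 ⟨a, ha, rfl⟩,
      by simp⟩)
  have hVLπ : ∀ v ∈ VL, π v ∈ VL := by
    intro v hv
    rcases hpred v with ⟨h, -⟩ | ⟨h, -⟩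
    · exact (hVLE _ (hSE (List.mem_toFinset.1 h))).1
    · rw [hπ, h]; exact hv
  -- the edges that the walk uses
  set Q : ((N × ℕ) × (N × ℕ)) × ℕ × List (N × N) → Prop := fun e => e ∈ D ∧
    (e.2.2 = [] ∨ ∃ a, (a ∈ F₀ ∧ e = (((a.1, 0), (a.2, 0)), w a, [a])) ∨
      (a ∈ F ∧ a ∉ F₀ ∧ e = (((a.1, 1), (π a.2, 1)), w a, [a]))) with hQ
  have hlift : ∀ p, ReflTransGen (AuxStep F₀ (F \ F₀) π) (r, 0) p → p.1 ∈ VL ∧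
      ReflTransGen (fun x y => ∃ c, Q ((x, y), c)) (r, 0) p := by
    intro p hp
    induction hp with
    | refl => exact ⟨by simp [hVL], .refl⟩
    | tail _ hstep ih =>
      obtain ⟨hmem, ih⟩ := ih
      cases hstep with
      | @first u v huv =>
        have huvF := (Finset.mem_filter.1 huv)
        have huvE := List.mem_toFinset.1 (hFE huvF.1)
        have huvG := List.mem_toFinset.1 (hF.mem_of_carries _ huvF.1 huvF.2)
        refine ⟨(hVLE _ huvE).2, ih.tail ⟨(w (u, v), [(u, v)]), ?_, .inr ⟨(u, v), .inl ⟨huv, rfl⟩⟩⟩⟩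
        refine List.mem_append_right _ (List.mem_map.2 ⟨((u, v), w (u, v)),
          List.mem_filter.2 ⟨List.mem_map.2 ⟨_, huvE, rfl⟩, by simpa using huvG⟩, rfl⟩)
      | @second u v huv =>
        obtain ⟨huvF, huv₀⟩ := Finset.mem_sdiff.1 huv
        have huvE := List.mem_toFinset.1 (hFE huvF)
        refine ⟨hVLπ _ (hVLE _ huvE).2,
          ih.tail ⟨(w (u, v), [(u, v)]), ?_, .inr ⟨(u, v), .inr ⟨huvF, huv₀, rfl⟩⟩⟩⟩
        exact List.mem_append_left _ (List.mem_append_right _ (List.mem_map.2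
          ⟨((u, v), w (u, v)), List.mem_map.2 ⟨_, huvE, rfl⟩, rfl⟩))
      | switch v =>
        refine ⟨hmem, ih.tail ⟨(0, []), ?_, .inl rfl⟩⟩
        exact List.mem_append_left _ (List.mem_append_left _ (List.mem_flatMap.2
          ⟨v, hmem, by simp⟩))
      | back v =>
        refine ⟨hVLπ v hmem, ih.tail ⟨(0, []), ?_, .inl rfl⟩⟩
        exact List.mem_append_left _ (List.mem_append_left _ (List.mem_flatMap.2
          ⟨v, hmem, by simp [hπ]⟩))
  obtain ⟨l, hlQ, hnd, hlw⟩ := exists_nodup_isWalk (hlift _ hwalk).2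
  have hlD : l ⊆ D := fun e he => (hlQ e he).1
  refine ⟨t, List.mem_toFinset.1 ht, l, hlD, hnd, hlw, ?_⟩
  have hused : (l.flatMap fun e => e.2.2).Nodup := by
    rw [List.nodup_flatMap]
    constructor
    · intro e he
      rcases (hlQ e he).2 with h | ⟨a, ⟨-, rfl⟩ | ⟨-, -, rfl⟩⟩
      · rw [h]; exact List.nodup_nil
      · exact List.nodup_singleton _
      · exact List.nodup_singleton _
    · refine hnd.imp_of_mem fun {e e'} he he' hne => ?_
      intro b hb hb'
      rcases (hlQ e he).2 with h | ⟨a, h⟩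
      · simp [h] at hb
      rcases (hlQ e' he').2 with h' | ⟨a', h'⟩
      · simp [h'] at hb'
      have hab : b = a := by
        rcases h with ⟨-, rfl⟩ | ⟨-, -, rfl⟩ <;> simpa using hb
      have hab' : b = a' := by
        rcases h' with ⟨-, rfl⟩ | ⟨-, -, rfl⟩ <;> simpa using hb'
      subst hab
      subst hab'
      rcases h with ⟨h0, rfl⟩ | ⟨-, h0, rfl⟩ <;> rcases h' with ⟨h0', rfl⟩ | ⟨-, h0', rfl⟩
      · exact hne rfl
      · exact h0' h0
      · exact h0 h0'
      · exact hne rfl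
  rw [walkCost_eq hlD, ← List.sum_toFinset w hused]
  refine Finset.sum_le_sum_of_subset fun b hb => ?_
  obtain ⟨e, he, hbe⟩ := List.mem_flatMap.1 (List.mem_toFinset.1 hb)
  rcases (hlQ e he).2 with h | ⟨a, ⟨h, rfl⟩ | ⟨h, -, rfl⟩⟩
  · simp [h] at hbe
  · rw [List.mem_singleton.1 hbe]; exact (Finset.mem_filter.1 h).1
  · rw [List.mem_singleton.1 hbe]; exact h

omit [DecidableEq N] in
theorem List.sum_toFinset_le {α : Type} [DecidableEq α] (l : List α) (w : α → ℕ) :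
    ∑ a ∈ l.toFinset, w a ≤ (l.map w).sum := by
  rw [Finset.sum_list_map_count]
  refine Finset.sum_le_sum fun a ha => ?_
  rw [smul_eq_mul]
  exact Nat.le_mul_of_pos_left _ (List.count_pos_iff.2 (List.mem_toFinset.1 ha))

/-- If there is a feasible tree `F`, the algorithm returns one of weight at most the sum of the
weights of `S` and `F`. -/
theorem approxTree_spec (hT : T ≠ []) {w : N × N → ℕ} (hSE : S ⊆ E)
    (hS : IsTreeRootedAt r S.toFinset) (hST : ∀ t ∈ T, Reaches S.toFinset r t)
    {F : Finset (N × N)} (hFE : F ⊆ E.toFinset)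
    (hF : IsFeasibleTree r T.toFinset G.toFinset F) :
    (approxTree r T G (E.map fun a => (a, w a)) S).Sublist E ∧
    IsFeasibleTree r T.toFinset G.toFinset
      (approxTree r T G (E.map fun a => (a, w a)) S).toFinset ∧
    ∑ a ∈ (approxTree r T G (E.map fun a => (a, w a)) S).toFinset, w a ≤
      ∑ a ∈ S.toFinset, w a + ∑ a ∈ F, w a := by
  set X := augmentingArcs r T G (E.map fun a => (a, w a)) S with hX
  set E' := E.filter fun a => decide (a ∈ S) || decide (a ∈ X) with hE'
  have hout : approxTree r T G (E.map fun a => (a, w a)) S = prune r T G E' := by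
    simp [approxTree, hE', hX, Function.comp_def]
  set D := auxEdges r G (E.map fun a => (a, w a)) (pathArcs S (lastOr r T)) with hD
  set L := (labels ((r, 0) : N × ℕ) D).filter fun c => decide (c.1.2 = 1) && decide (c.1.1 ∈ T)
    with hL
  have hmemL : ∀ c, c ∈ L ↔ c ∈ labels ((r, 0) : N × ℕ) D ∧ c.1.2 = 1 ∧ c.1.1 ∈ T := by
    intro c; simp [hL]
  obtain ⟨t, ht, l, hlD, hnd, hlw, hcost⟩ :=
    exists_cheap_isWalk (w := w) hT hSE hS hST hFE hF
  obtain ⟨c, hc, hct, hcl⟩ := exists_mem_labels hlw hlD hnd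
  have hcL : c ∈ L := (hmemL c).2 ⟨hc, by rw [hct], by rwa [hct]⟩
  -- the label whose arcs are chosen
  obtain ⟨d, hdL, hd, hdmin⟩ := (cheapest_spec L).resolve_left
    fun h => by rw [h.2] at hcL; simp at hcL
  have hXd : X = d.2.2 := by
    change (cheapest L).flatMap _ = _
    simp [hd]
  obtain ⟨hdlab, hd1, hdT⟩ := (hmemL d).1 hdL
  obtain ⟨m, hmD, hmw, hmcost, hmX⟩ := exists_isWalk_of_mem_labels hdlab
  have hXcost : (X.map w).sum ≤ ∑ a ∈ F, w a := by
    rw [hXd, hmX, ← walkCost_eq hmD, ← hmcost]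
    exact (hdmin c hcL).trans (hcl.trans hcost)
  have hXE : ∀ a ∈ X, a ∈ E := by
    intro a ha
    rw [hXd, hmX, List.mem_flatMap] at ha
    obtain ⟨e, he, hae⟩ := ha
    have he' := hmD he
    simp only [hD, auxEdges, List.mem_append, List.mem_flatMap, List.mem_map, List.mem_filter,
      decide_eq_true_eq, List.mem_cons, List.not_mem_nil, or_false] at he'
    rcases he' with (⟨v, -, rfl | rfl⟩ | ⟨_, ⟨b, hb, rfl⟩, rfl⟩) | ⟨_, ⟨⟨b, hb, rfl⟩, -⟩, rfl⟩
    · simp at hae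
    · simp at hae
    · rwa [List.mem_singleton.1 hae]
    · rwa [List.mem_singleton.1 hae]
  have hE'mem : ∀ a, a ∈ E' ↔ a ∈ S ∨ a ∈ X := by
    intro a
    simp only [hE', List.mem_filter, Bool.or_eq_true, decide_eq_true_eq, and_iff_right_iff_imp]
    exact fun h => h.elim (fun h => hSE h) (hXE a)
  have hSE' : S.toFinset ⊆ E'.toFinset := fun a ha => by
    rw [List.mem_toFinset] at ha ⊢
    exact (hE'mem a).2 (.inl ha)
  have haux : ReflTransGen (AuxStep (E'.toFinset ∩ G.toFinset) E'.toFinset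
      (predecessor (pathArcs S (lastOr r T)))) (r, 0) (d.1.1, 1) := by
    have := auxReaches_of_isWalk hmw hmD (X := E'.toFinset) fun e he a ha => by
      rw [List.mem_toFinset, hE'mem, hXd, hmX]
      exact .inr (List.mem_flatMap.2 ⟨e, he, ha⟩)
    rwa [← hd1]
  have htest : noBottleneckTest r T G E' = true :=
    (noBottleneckTest_iff hT).2 (noBottleneck_of_auxReaches hS hSE'
      (fun t ht => hST t (List.mem_toFinset.1 ht)) (List.mem_toFinset.2 (lastOr_mem r hT))
      (isPathPredecessor_predecessor S _) (List.mem_toFinset.2 hdT) haux)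
  obtain ⟨hsub, hfeas⟩ := prune_spec hT htest
  rw [hout]
  refine ⟨hsub.trans List.filter_sublist, hfeas, ?_⟩
  calc ∑ a ∈ (prune r T G E').toFinset, w a
      ≤ ∑ a ∈ S.toFinset ∪ X.toFinset, w a := by
        refine Finset.sum_le_sum_of_subset fun a ha => ?_
        have := (hE'mem a).1 (hsub.subset (List.mem_toFinset.1 ha))
        simpa using this
    _ ≤ ∑ a ∈ S.toFinset, w a + ∑ a ∈ X.toFinset, w a := by
        rw [← Finset.sum_union_inter]; exact Nat.le_add_right _ _
    _ ≤ ∑ a ∈ S.toFinset, w a + ∑ a ∈ F, w a := by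
        exact Nat.add_le_add_left ((List.sum_toFinset_le X w).trans hXcost) _

end Algorithm

namespace PolyTime

variable {α N : Type} [Enc α] [Enc N] [DecidableEq N] [InjectiveEnc N]

@[fun_prop]
theorem noBottleneckTest {r : α → N} {T : α → List N} {G E : α → List (N × N)} (hr : PolyTime r)
    (hT : PolyTime T) (hG : PolyTime G) (hE : PolyTime E) :
    PolyTime (fun a => noBottleneckTest (r a) (T a) (G a) (E a)) := by
  unfold _root_.noBottleneckTest
  fun_prop

@[fun_prop]
theorem prune {r : α → N} {T : α → List N} {G E : α → List (N × N)} (hr : PolyTime r)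
    (hT : PolyTime T) (hG : PolyTime G) (hE : PolyTime E) :
    PolyTime (fun a => prune (r a) (T a) (G a) (E a)) := by
  refine hE.foldl (c := E) (s := fun a F e =>
    if _root_.noBottleneckTest (r a) (T a) (G a) (F.filter fun e' => !decide (e' = e)) = true then
      F.filter fun e' => !decide (e' = e) else F) hE (by fun_prop) ?_
  obtain ⟨p, hp⟩ := hE.exists_size_le
  refine ⟨p, fun a m hm => (size_enc_le_of_sublist ?_).trans (hp a)⟩
  clear hm
  induction m using List.reverseRecOn with
  | nil => exact List.Sublist.refl _
  | append_singleton m b ih =>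
    rw [List.foldl_append, List.foldl_cons, List.foldl_nil]
    split_ifs
    · exact List.filter_sublist.trans ih
    · exact ih

@[fun_prop]
theorem pathArcs {S : α → List (N × N)} {t : α → N} (hS : PolyTime S) (ht : PolyTime t) :
    PolyTime (fun a => pathArcs (S a) (t a)) := by
  unfold _root_.pathArcs
  fun_prop

@[fun_prop]
theorem predecessor {P : α → List (N × N)} {x : α → N} (hP : PolyTime P) (hx : PolyTime x) :
    PolyTime (fun a => predecessor (P a) (x a)) := by
  refine hP.foldl (c := x) (s := fun a u e => if decide (e.2 = x a) = true then e.1 else u) hx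
    (by fun_prop) ?_
  obtain ⟨p, hp⟩ := hP.exists_size_le
  obtain ⟨q, hq⟩ := hx.exists_size_le
  refine ⟨p + q, fun a m hm => ?_⟩
  change (enc (_root_.predecessor m (x a))).size ≤ _
  have h1 := hp a
  have h2 := hq a
  rw [Polynomial.eval_add]
  rcases predecessor_spec m (x a) with h | ⟨h, -⟩
  · have := size_enc_lt_of_mem (hm.subset h)
    rw [size_enc_prod] at this
    dsimp only at this
    omega
  · rw [h]; omega

omit [InjectiveEnc N] [DecidableEq N] in
@[fun_prop]
theorem lastOr {r : α → N} {T : α → List N} (hr : PolyTime r) (hT : PolyTime T) :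
    PolyTime (fun a => lastOr (r a) (T a)) := by
  refine hT.foldl (c := r) (s := fun _ _ t => t) hr (by fun_prop) ?_
  obtain ⟨p, hp⟩ := hr.exists_size_le
  obtain ⟨q, hq⟩ := hT.exists_size_le
  refine ⟨p + q, fun a m hm => ?_⟩
  change (enc (_root_.lastOr (r a) m)).size ≤ _
  have h1 := hp a
  have h2 := hq a
  rw [Polynomial.eval_add]
  by_cases h : m = []
  · rw [h]; exact h1.trans (Nat.le_add_right _ _)
  · have := size_enc_lt_of_mem (hm.subset (lastOr_mem (r a) h))
    omega

@[fun_prop]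
theorem auxEdges {r : α → N} {G : α → List (N × N)} {A : α → List ((N × N) × ℕ)}
    {P : α → List (N × N)} (hr : PolyTime r) (hG : PolyTime G) (hA : PolyTime A)
    (hP : PolyTime P) : PolyTime (fun a => auxEdges (r a) (G a) (A a) (P a)) := by
  unfold _root_.auxEdges
  fun_prop

@[fun_prop]
theorem augmentingArcs {r : α → N} {T : α → List N} {G : α → List (N × N)}
    {A : α → List ((N × N) × ℕ)} {S : α → List (N × N)} (hr : PolyTime r) (hT : PolyTime T)
    (hG : PolyTime G) (hA : PolyTime A) (hS : PolyTime S) :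
    PolyTime (fun a => augmentingArcs (r a) (T a) (G a) (A a) (S a)) := by
  unfold _root_.augmentingArcs
  fun_prop

@[fun_prop]
theorem approxTree {r : α → N} {T : α → List N} {G : α → List (N × N)}
    {A : α → List ((N × N) × ℕ)} {S : α → List (N × N)} (hr : PolyTime r) (hT : PolyTime T)
    (hG : PolyTime G) (hA : PolyTime A) (hS : PolyTime S) :
    PolyTime (fun a => approxTree (r a) (T a) (G a) (A a) (S a)) := by
  unfold _root_.approxTree
  fun_prop

end PolyTime

/-! ### Renaming vertices -/

section Image

variable {V W : Type} [DecidableEq W] {f : V → W}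

open Relation

theorem reaches_image_iff (hf : Function.Injective f) {F : Finset (V × V)} {u v : V} :
    Reaches (F.image (Prod.map f f)) (f u) (f v) ↔ Reaches F u v := by
  constructor
  · have key : ∀ y, Reaches (F.image (Prod.map f f)) (f u) y → ∃ x, f x = y ∧ Reaches F u x := by
      intro y hy
      induction hy with
      | refl => exact ⟨u, rfl, .refl⟩
      | tail _ h ih =>
        obtain ⟨x, rfl, hx⟩ := ih
        obtain ⟨⟨a, b⟩, hab, heq⟩ := Finset.mem_image.1 h
        obtain ⟨ha, rfl⟩ := Prod.mk.inj heq
        obtain rfl := hf ha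
        exact ⟨b, rfl, hx.tail hab⟩
    intro h
    obtain ⟨x, hx, hux⟩ := key _ h
    exact hf hx ▸ hux
  · exact fun h => ReflTransGen.lift f (fun a b hab => Finset.mem_image_of_mem (Prod.map f f) hab)
      _ _ h

theorem isTreeRootedAt_image_iff (hf : Function.Injective f) {r : V} {F : Finset (V × V)} :
    IsTreeRootedAt (f r) (F.image (Prod.map f f)) ↔ IsTreeRootedAt r F := by
  constructor
  · rintro ⟨h1, h2, h3⟩
    refine ⟨fun a ha h => h1 _ (Finset.mem_image_of_mem _ ha) (congrArg f h),
      fun a ha b hb h => hf.prodMap hf (h2 _ (Finset.mem_image_of_mem _ ha) _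
        (Finset.mem_image_of_mem _ hb) (congrArg f h)),
      fun a ha => (reaches_image_iff hf).1 (h3 _ (Finset.mem_image_of_mem _ ha))⟩
  · rintro ⟨h1, h2, h3⟩
    refine ⟨fun a ha => ?_, fun a ha b hb h => ?_, fun a ha => ?_⟩
    · obtain ⟨a, ha', rfl⟩ := Finset.mem_image.1 ha
      exact fun h => h1 a ha' (hf h)
    · obtain ⟨a, ha', rfl⟩ := Finset.mem_image.1 ha
      obtain ⟨b, hb', rfl⟩ := Finset.mem_image.1 hb
      rw [h2 a ha' b hb' (hf h)]
    · obtain ⟨a, ha', rfl⟩ := Finset.mem_image.1 ha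
      exact (reaches_image_iff hf).2 (h3 a ha')

theorem isFeasibleTree_image_iff (hf : Function.Injective f) {r : V} {T : Finset V}
    {G F : Finset (V × V)} :
    IsFeasibleTree (f r) (T.image f) (G.image (Prod.map f f)) (F.image (Prod.map f f)) ↔
      IsFeasibleTree r T G F := by
  have hmem : ∀ {H : Finset (V × V)} {a : V × V},
      Prod.map f f a ∈ H.image (Prod.map f f) ↔ a ∈ H := fun {H a} =>
    (hf.prodMap hf).mem_finset_image
  have hcarry : ∀ a : V × V, (∀ t ∈ T.image f, Reaches (F.image (Prod.map f f)) (f a.2) t) ↔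
      ∀ t ∈ T, Reaches F a.2 t := fun a => by
    simp only [Finset.forall_mem_image, reaches_image_iff hf]
  constructor
  · rintro ⟨h1, h2, h3⟩
    refine ⟨(isTreeRootedAt_image_iff hf).1 h1, fun t ht => (reaches_image_iff hf).1
      (h2 _ (Finset.mem_image_of_mem _ ht)), fun a ha h => hmem.1 (h3 _ (hmem.2 ha) ?_)⟩
    exact (hcarry a).2 h
  · rintro ⟨h1, h2, h3⟩
    refine ⟨(isTreeRootedAt_image_iff hf).2 h1, ?_, ?_⟩
    · simpa only [Finset.forall_mem_image, reaches_image_iff hf] using h2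
    · intro b hb h
      obtain ⟨a, ha, rfl⟩ := Finset.mem_image.1 hb
      exact hmem.2 (h3 a ha ((hcarry a).1 h))

end Image

/-! ### Instances -/

/-- Written instances of ML-CAP-STEINER-TREE: number of vertices, root, terminals, and arcs with
numerator and denominator of the length and with the capacity. -/
abbrev CapData : Type := ℕ × ℕ × List ℕ × List ((ℕ × ℕ) × (ℕ × ℕ) × ℕ)

namespace CapData

/-- The arcs of the graph. -/
def arcs (x : CapData) : List (ℕ × ℕ) := x.2.2.2.map fun e => e.1

/-- The arcs whose capacity is at least the number of terminals. -/
def uncapacitatedArcs (x : CapData) : List (ℕ × ℕ) :=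
  (x.2.2.2.filter fun e => !decide (e.2.2 < x.2.2.1.length)).map fun e => e.1

/-- A common denominator of all lengths. -/
def commonDen (x : CapData) : ℕ := (x.2.2.2.map fun e => e.2.1.2).prod

/-- The arcs with their lengths, multiplied by the common denominator. -/
def scaledArcs (x : CapData) : List ((ℕ × ℕ) × ℕ) :=
  x.2.2.2.map fun e => (e.1, e.2.1.1 * (x.commonDen / e.2.1.2))

/-- The instance of STEINER-TREE, as it is written. -/
def dropCaps (x : CapData) : ℕ × ℕ × List ℕ × List ((ℕ × ℕ) × (ℕ × ℕ)) :=
  (x.1, x.2.1, x.2.2.1, x.2.2.2.map fun e => (e.1, e.2.1))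

/-- The decision algorithm. -/
def decideFeasible (x : CapData) : Bool :=
  noBottleneckTest x.2.1 x.2.2.1 x.uncapacitatedArcs x.arcs

/-- The approximation algorithm, given a Steiner tree. -/
def approximate (p : CapData × List (ℕ × ℕ)) : Value :=
  if p.1.decideFeasible = true then
    enc (1, approxTree p.1.2.1 p.1.2.2.1 p.1.uncapacitatedArcs p.1.scaledArcs p.2)
  else .nat 0

end CapData

namespace PolyTime

variable {α : Type} [Enc α]

@[fun_prop]
theorem capData_arcs {x : α → CapData} (hx : PolyTime x) : PolyTime (fun a => (x a).arcs) := by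
  unfold CapData.arcs
  fun_prop

@[fun_prop]
theorem capData_uncapacitatedArcs {x : α → CapData} (hx : PolyTime x) :
    PolyTime (fun a => (x a).uncapacitatedArcs) := by
  unfold CapData.uncapacitatedArcs
  fun_prop

@[fun_prop]
theorem capData_commonDen {x : α → CapData} (hx : PolyTime x) :
    PolyTime (fun a => (x a).commonDen) := by
  unfold CapData.commonDen
  fun_prop

@[fun_prop]
theorem capData_scaledArcs {x : α → CapData} (hx : PolyTime x) :
    PolyTime (fun a => (x a).scaledArcs) := by
  unfold CapData.scaledArcs
  fun_prop

@[fun_prop]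
theorem capData_decideFeasible {x : α → CapData} (hx : PolyTime x) :
    PolyTime (fun a => (x a).decideFeasible) := by
  unfold CapData.decideFeasible
  fun_prop

theorem capData_dropCaps : PolyTime CapData.dropCaps := by
  unfold CapData.dropCaps
  fun_prop

theorem capData_approximate : PolyTime CapData.approximate := by
  unfold CapData.approximate
  fun_prop

end PolyTime

theorem polyTimeSolvable_iff {ι : Type} {input : ι → Value} {R : ι → Value → Prop} :
    PolyTimeSolvable input R ↔ ∃ g, Computes input g ∧ ∀ i, R i (g i) := by
  constructor
  · rintro ⟨P, p, h⟩
    choose g t h1 h2 h3 using h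
    exact ⟨g, ⟨P, p, fun i => ⟨t i, h1 i, h2 i⟩⟩, h3⟩
  · rintro ⟨g, ⟨P, p, h⟩, hR⟩
    refine ⟨P, p, fun i => ?_⟩
    obtain ⟨t, h1, h2⟩ := h i
    exact ⟨g i, t, h1, h2, hR i⟩

/-- An arc, with its ends as natural numbers. -/
def natArc {n : ℕ} (a : Fin n × Fin n) : ℕ × ℕ := Prod.map Fin.val Fin.val a

theorem natArc_injective {n : ℕ} : Function.Injective (natArc (n := n)) :=
  Fin.val_injective.prodMap Fin.val_injective

theorem arcsOutput_eq {n : ℕ} (L : List (Fin n × Fin n)) : arcsOutput L = enc (L.map natArc) := by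
  simp only [arcsOutput, enc, List.map_map]
  rfl

namespace SteinerInstance

variable (I : SteinerInstance)

theorem mem_arcList (a : Fin I.n × Fin I.n) : a ∈ I.arcList ↔ a ∈ I.arcs := by
  obtain ⟨u, v⟩ := a
  simp [arcList, List.mem_product]

theorem toFinset_terminalList : I.terminalList.toFinset = I.terminals := by
  ext; simp [terminalList]

theorem length_terminalList : I.terminalList.length = I.terminals.card := by
  rw [← toFinset_terminalList, List.toFinset_card_of_nodup]
  exact (List.nodup_finRange _).filter _

theorem terminalList_ne_nil : I.terminalList ≠ [] := by
  intro h
  have h1 := I.length_terminalList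
  have h2 := I.two_le_card
  rw [h] at h1
  simp at h1
  omega

end SteinerInstance

namespace CapSteinerInstance

variable (I : CapSteinerInstance)

/-- The data that are written as the input of programs. -/
def data : CapData :=
  (I.n, (I.root : ℕ), I.terminalList.map Fin.val, I.arcList.map fun a =>
    (natArc a, ((I.length a).num, (I.length a).den), I.cap a))

theorem enc_data : enc I.data = I.input := by
  -- in `input`, the terminals are coerced to numbers in the list monad
  simp only [enc, data, input, List.bind_eq_flatMap, List.pure_def, ← List.map_eq_flatMap,
    List.map_map]
  rfl

theorem enc_dropCaps_data : enc I.data.dropCaps = I.toSteinerInstance.input := by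
  simp only [enc, data, CapData.dropCaps, SteinerInstance.input, List.bind_eq_flatMap,
    List.pure_def, ← List.map_eq_flatMap, List.map_map]
  rfl

theorem arcs_data : I.data.arcs = I.arcList.map natArc := by
  simp [data, CapData.arcs]

theorem toFinset_arcs_data : I.data.arcs.toFinset = I.arcs.image natArc := by
  ext; simp [arcs_data, SteinerInstance.mem_arcList]

theorem toFinset_terminals_data : I.data.2.2.1.toFinset = I.terminals.image Fin.val := by
  change (I.terminalList.map Fin.val).toFinset = _
  rw [← SteinerInstance.toFinset_terminalList]
  ext; simp

theorem terminals_data_ne_nil : I.data.2.2.1 ≠ [] := by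
  simp [data, SteinerInstance.terminalList_ne_nil]

theorem toFinset_uncapacitatedArcs_data : I.data.uncapacitatedArcs.toFinset =
    (I.arcs.filter fun a => I.terminals.card ≤ I.cap a).image natArc := by
  ext
  simp [data, CapData.uncapacitatedArcs, SteinerInstance.length_terminalList,
    SteinerInstance.mem_arcList]
  exact exists₂_congr fun _ _ => and_right_comm

variable {I}

/-- If all capacities are at least `K - 1`, an arc violates its capacity only if its capacity is
`K - 1` and the subtree at its head contains all terminals. -/
theorem isFeasible_iff (hI : I.LargeCapacities) {F : Finset (Fin I.n × Fin I.n)} :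
    I.IsFeasible F ↔ F ⊆ I.arcs ∧ IsFeasibleTree I.root I.terminals
      (I.arcs.filter fun a => I.terminals.card ≤ I.cap a) F := by
  constructor
  · rintro ⟨⟨h1, h2, h3⟩, h4⟩
    refine ⟨h1, h2, h3, fun a ha hall => Finset.mem_filter.2 ⟨h1 ha, ?_⟩⟩
    refine le_trans (le_of_eq ?_) (h4 a ha)
    rw [← Set.ncard_coe_finset]
    congr 1
    ext t
    exact ⟨fun ht => ⟨ht, hall t ht⟩, fun ht => ht.1⟩
  · rintro ⟨h1, h2, h3, h4⟩
    refine ⟨⟨h1, h2, h3⟩, fun a ha => ?_⟩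
    by_cases hall : ∀ t ∈ I.terminals, Reaches F a.2 t
    · refine le_trans ?_ (Finset.mem_filter.1 (h4 a ha hall)).2
      rw [← Set.ncard_coe_finset]
      exact Set.ncard_le_ncard (fun t ht => ht.1) (Finset.finite_toSet _)
    · push Not at hall
      obtain ⟨t, ht, hnot⟩ := hall
      refine le_trans (Nat.le_sub_one_of_lt ?_) (hI a (h1 ha))
      rw [← Set.ncard_coe_finset]
      refine Set.ncard_lt_ncard ⟨fun t ht => ht.1, fun h => ?_⟩ (Finset.finite_toSet _)
      exact hnot (h ht).2

theorem isFeasible_iff_image (hI : I.LargeCapacities) {F : Finset (Fin I.n × Fin I.n)} :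
    I.IsFeasible F ↔ F.image natArc ⊆ I.data.arcs.toFinset ∧ IsFeasibleTree I.data.2.1
      I.data.2.2.1.toFinset I.data.uncapacitatedArcs.toFinset (F.image natArc) := by
  rw [isFeasible_iff hI, toFinset_arcs_data, toFinset_terminals_data,
    toFinset_uncapacitatedArcs_data, Finset.image_subset_image_iff natArc_injective]
  exact and_congr_right fun _ => (isFeasibleTree_image_iff Fin.val_injective).symm

theorem decideFeasible_data_iff (hI : I.LargeCapacities) :
    I.data.decideFeasible = true ↔ ∃ F, I.IsFeasible F := by
  rw [CapData.decideFeasible, noBottleneckTest_iff_exists I.terminals_data_ne_nil]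
  constructor
  · rintro ⟨F', hF', hfeas⟩
    rw [toFinset_arcs_data, Finset.subset_image_iff] at hF'
    obtain ⟨F, hF, rfl⟩ := hF'
    refine ⟨F, (isFeasible_iff_image hI).2 ⟨?_, hfeas⟩⟩
    rw [toFinset_arcs_data]
    exact Finset.image_subset_image hF
  · rintro ⟨F, hF⟩
    exact ⟨_, (isFeasible_iff_image hI).1 hF⟩

variable (I)

/-- The length of an arc, multiplied by the common denominator; `0` outside the graph. -/
noncomputable def weight : ℕ × ℕ → ℕ :=
  Function.extend natArc
    (fun a => (I.length a).num * (I.data.commonDen / (I.length a).den)) 0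

theorem scaledArcs_data : I.data.scaledArcs = I.data.arcs.map fun a => (a, I.weight a) := by
  rw [arcs_data, CapData.scaledArcs, List.map_map]
  change List.map _ (I.arcList.map _) = _
  rw [List.map_map]
  refine List.map_congr_left fun a _ => ?_
  simp only [Function.comp_apply, weight, natArc_injective.extend_apply]

theorem commonDen_pos : 0 < I.data.commonDen := by
  refine List.prod_pos fun d hd => ?_
  simp only [data, List.map_map, List.mem_map, Function.comp_apply] at hd
  obtain ⟨a, -, rfl⟩ := hd
  exact (I.length a).den_pos

theorem weight_natArc {a : Fin I.n × Fin I.n} (ha : a ∈ I.arcs) :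
    (I.weight (natArc a) : ℚ≥0) = I.length a * I.data.commonDen := by
  have hdvd : (I.length a).den ∣ I.data.commonDen := by
    refine List.dvd_prod ?_
    simp only [data, List.map_map, List.mem_map, Function.comp_apply]
    exact ⟨a, (I.mem_arcList a).2 ha, rfl⟩
  obtain ⟨c, hc⟩ := hdvd
  rw [weight, natArc_injective.extend_apply, hc, Nat.mul_div_cancel_left _ (I.length a).den_pos]
  have hden : ((I.length a).den : ℚ≥0) ≠ 0 := by exact_mod_cast (I.length a).den_ne_zero
  have hlen : I.length a * (I.length a).den = (I.length a).num :=
    (eq_div_iff hden).1 (NNRat.num_div_den (I.length a)).symm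
  push_cast
  rw [← mul_assoc, hlen]

theorem sum_weight {F : Finset (Fin I.n × Fin I.n)} (hF : F ⊆ I.arcs) :
    ((∑ a ∈ F.image natArc, I.weight a : ℕ) : ℚ≥0) = I.totalLength F * I.data.commonDen := by
  rw [Finset.sum_image natArc_injective.injOn, SteinerInstance.totalLength, Finset.sum_mul]
  push_cast
  exact Finset.sum_congr rfl fun a ha => I.weight_natArc (hF ha)

variable {I}

theorem approximate_spec (hI : I.LargeCapacities) {S : List (Fin I.n × Fin I.n)}
    (hS : I.IsSteinerTree S.toFinset) (hfeas : ∃ F, I.IsFeasible F) :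
    ∃ L : List (Fin I.n × Fin I.n),
      CapData.approximate (I.data, S.map natArc) = .pair (.nat 1) (arcsOutput L) ∧
      I.IsFeasible L.toFinset ∧ ∀ F, I.IsFeasible F →
        I.totalLength L.toFinset ≤ I.totalLength S.toFinset + I.totalLength F := by
  have himage : ∀ L : List (Fin I.n × Fin I.n),
      (L.map natArc).toFinset = L.toFinset.image natArc := by
    intro L; ext; simp
  have hSE : S.map natArc ⊆ I.data.arcs := by
    rw [arcs_data]
    intro a ha
    obtain ⟨b, hb, rfl⟩ := List.mem_map.1 ha
    exact List.mem_map.2 ⟨b, (I.mem_arcList b).2 (hS.subset (List.mem_toFinset.2 hb)), rfl⟩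
  have htree : IsTreeRootedAt I.data.2.1 (S.map natArc).toFinset := by
    rw [himage]
    exact (isTreeRootedAt_image_iff Fin.val_injective).2 hS.tree
  have hspan : ∀ t ∈ I.data.2.2.1, Reaches (S.map natArc).toFinset I.data.2.1 t := by
    intro t ht
    rw [himage]
    obtain ⟨u, hu, rfl⟩ := List.mem_map.1 ht
    refine (reaches_image_iff Fin.val_injective).2 (hS.spans u ?_)
    rwa [← SteinerInstance.toFinset_terminalList, List.mem_toFinset]
  have hspec : ∀ F, I.IsFeasible F → _ := fun F hF =>
    approxTree_spec (w := I.weight) I.terminals_data_ne_nil hSE htree hspan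
      ((isFeasible_iff_image hI).1 hF).1 ((isFeasible_iff_image hI).1 hF).2
  rw [← scaledArcs_data] at hspec
  obtain ⟨F₀, hF₀⟩ := hfeas
  obtain ⟨hsub, hout, -⟩ := hspec F₀ hF₀
  have hsub' := hsub
  rw [arcs_data] at hsub'
  obtain ⟨L, hL, hLout⟩ := List.sublist_map_iff.1 hsub'
  rw [hLout] at hspec hsub hout
  have hLfeas : I.IsFeasible L.toFinset := by
    rw [isFeasible_iff_image hI, ← himage]
    exact ⟨fun a ha => List.mem_toFinset.2 (hsub.subset (List.mem_toFinset.1 ha)), hout⟩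
  refine ⟨L, ?_, hLfeas, fun F hF => ?_⟩
  · rw [CapData.approximate, if_pos ((decideFeasible_data_iff hI).2 ⟨F₀, hF₀⟩), hLout,
      arcsOutput_eq]
    rfl
  · have h := (hspec F hF).2.2
    rw [himage, himage] at h
    have hD : (0 : ℚ≥0) < I.data.commonDen := by exact_mod_cast I.commonDen_pos
    have h' : ((∑ a ∈ L.toFinset.image natArc, I.weight a : ℕ) : ℚ≥0) ≤
        ((∑ a ∈ S.toFinset.image natArc, I.weight a : ℕ) : ℚ≥0) +
          ((∑ a ∈ F.image natArc, I.weight a : ℕ) : ℚ≥0) := by exact_mod_cast h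
    rw [I.sum_weight hLfeas.steiner.subset, I.sum_weight hS.subset,
      I.sum_weight hF.steiner.subset, ← add_mul] at h'
    exact le_of_mul_le_mul_right h' hD

end CapSteinerInstance

/-! ### Solvability in polynomial time -/

/-- The instances with graph of type `C` and all capacities at least `K - 1`. -/
abbrev LargeCapInstance (C : GraphClass) : Type :=
  {I : CapSteinerInstance // I.InClass C ∧ I.LargeCapacities}

theorem capSteinerPolyTime (C : GraphClass) : CapSteinerPolyTime C := by
  refine polyTimeSolvable_iff.2 ⟨fun I => enc I.1.data.decideFeasible, ?_, ?_⟩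
  · have h : PolyTime CapData.decideFeasible := by fun_prop
    simp only [← CapSteinerInstance.enc_data]
    exact Computes.reindex h fun I : LargeCapInstance C => I.1.data
  · rintro ⟨I, -, hI⟩
    dsimp only
    rw [← CapSteinerInstance.decideFeasible_data_iff hI]
    cases I.data.decideFeasible <;> simp [enc]

theorem mainTheorem3 (C : GraphClass) :
    CapSteinerPolyTime C ∧
      ∀ ρ : SteinerInstance → ℝ, (∀ I, I.InClass C → 1 ≤ ρ I) → SteinerApproximable C ρ →
        CapSteinerApproximable C (fun I => 1 + ρ I.toSteinerInstance) := by
  refine ⟨capSteinerPolyTime C, fun ρ _ hρ => ?_⟩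
  obtain ⟨g, hg, hgR⟩ := polyTimeSolvable_iff.1 hρ
  refine polyTimeSolvable_iff.2 ?_
  -- the Steiner tree of the instance without capacities
  choose S hS hSt hSρ using fun I : LargeCapInstance C => hgR ⟨I.1.toSteinerInstance, I.2.1.1⟩
  have hdrop : Computes (fun I : LargeCapInstance C => enc I.1.data)
      (fun I : LargeCapInstance C => enc I.1.data.dropCaps) :=
    Computes.reindex PolyTime.capData_dropCaps fun I : LargeCapInstance C => I.1.data
  have htree : Computes (fun I : LargeCapInstance C => enc I.1.data)
      (fun I => enc ((S I).map natArc)) := by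
    refine hdrop.comp ?_
    simp only [CapSteinerInstance.enc_dropCaps_data, ← arcsOutput_eq, ← hS]
    exact hg.reindex fun I : LargeCapInstance C => ⟨I.1.toSteinerInstance, I.2.1.1⟩
  refine ⟨fun I : LargeCapInstance C =>
    CapData.approximate (I.1.data, (S I).map natArc), ?_, fun I => ?_⟩
  · simp only [← CapSteinerInstance.enc_data]
    exact (Computes.id.pair htree).comp (Computes.reindex PolyTime.capData_approximate fun I :
      LargeCapInstance C => (I.1.data, (S I).map natArc))
  · by_cases hfeas : ∃ F, I.1.IsFeasible F
    · obtain ⟨L, hL, hLfeas, hle⟩ := CapSteinerInstance.approximate_spec I.2.2 (hSt I) hfeas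
      refine .inl ⟨L, hL, hLfeas, fun F hF => ?_⟩
      have h1 : (I.1.totalLength L.toFinset : ℝ) ≤
          I.1.totalLength (S I).toFinset + I.1.totalLength F := by exact_mod_cast hle F hF
      have h2 := hSρ I F hF.steiner
      linarith
    · refine .inr ⟨?_, hfeas⟩
      rw [← CapSteinerInstance.decideFeasible_data_iff I.2.2] at hfeas
      exact if_neg hfeas
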